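/- Let $\ell>0$, $0<a\le b<\infty$ and $t>0$. For weights $m,n\in L^\infty([0,\ell])$ bounded below by a positive constant, consider the problem $$-u''=\lambda\,\bigl(m(x)\,u^+-t\,n(x)\,u^-\bigr)\ \text{ in }(0,\ell),\qquad u(0)=u(\ell)=0,\qquad u^\pm=\max\{0,\pm u\},$$ understood in the weak sense: $u\in H^1_0(0,\ell)$ and $\int_0^\ell u'v'\,dx=\int_0^\ell\lambda\,(m u^+-t\,n u^-)\,v\,dx$ for all $v\in H^1_0(0,\ell)$. Let $\Sigma_t^{+}(m,n)$ (respectively $\Sigma_t^{-}(m,n)$) be the set of $\lambda\in\mathbb R$ for which there is a nontrivial weak solution $u$ with $u'(0)>0$ (respectively $u'(0)<0$). Let $\{m_\varepsilon\}_{\varepsilon>0}$, $\{n_\varepsilon\}_{\varepsilon>0}\subset L^\infty([0,\ell])$ satisfy $a\le m_\varepsilon,n_\varepsilon\le b$ a.e. in $[0,\ell]$ for every $\varepsilon>0$, and suppose that $m_\varepsilon\rightharpoonup m_0$ and $n_\varepsilon\rightharpoonup n_0$ weakly* in $L^\infty([0,\ell])$ as $\varepsilon\to0^+$, for some $m_0,n_0\in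 L^\infty([0,\ell])$. Then, for each $\varepsilon\ge0$, each of the two sets $\Sigma_t^{\pm}(m_\varepsilon,n_\varepsilon)$ consists exactly of the terms of a strictly increasing sequence $\lambda^{\pm}_{1,t,\varepsilon}<\lambda^{\pm}_{2,t,\varepsilon}<\cdots$ tending to $+\infty$, and for every $k\ge1$ and each choice of sign $$\lim_{\varepsilon\to0^+}\lambda^{\pm}_{k,t,\varepsilon}=\lambda^{\pm}_{k,t,0}.$$ -/

import Mathlib

open MeasureTheory Filter Set
open scoped Topology ContDiff ENNReal

noncomputable section

namespace HalfEigen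

/-- `m ∈ L^∞([0, ℓ])`. -/
def IsBoundedWeight (ℓ : ℝ) (m : ℝ → ℝ) : Prop :=
  MemLp m ∞ (volume.restrict (Icc 0 ℓ))

/-- The bounds `a ≤ m ≤ b`, almost everywhere on `[0, ℓ]`. -/
def BetweenBounds (ℓ a b : ℝ) (m : ℝ → ℝ) : Prop :=
  ∀ᵐ x ∂(volume.restrict (Icc 0 ℓ)), a ≤ m x ∧ m x ≤ b

/-- Weak* convergence `m ε ⇀ m₀` in `L^∞([0, ℓ]) = (L¹([0, ℓ]))*` as `ε → 0⁺`. -/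
def WeakStarTendsto (ℓ : ℝ) (m : ℝ → ℝ → ℝ) (m₀ : ℝ → ℝ) : Prop :=
  ∀ f : ℝ → ℝ, IntegrableOn f (Icc 0 ℓ) →
    Tendsto (fun ε : ℝ => ∫ x in (0 : ℝ)..ℓ, m ε x * f x) (𝓝[>] 0)
      (𝓝 (∫ x in (0 : ℝ)..ℓ, m₀ x * f x))

/-- `g` is the weak derivative of `u` on `(0, ℓ)`, tested against `C_c^∞(0, ℓ)`. -/
def HasWeakDeriv (ℓ : ℝ) (u g : ℝ → ℝ) : Prop :=
  ∀ φ : ℝ → ℝ, ContDiff ℝ ∞ φ → HasCompactSupport φ → tsupport φ ⊆ Ioo 0 ℓ →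
    ∫ x in (0 : ℝ)..ℓ, u x * deriv φ x = - ∫ x in (0 : ℝ)..ℓ, g x * φ x

/-- `u ∈ H¹₀(0, ℓ)`, with weak derivative `g`. An element of `H¹₀(0, ℓ)` is represented by its
continuous representative on `[0, ℓ]`, which vanishes at both end points (`u ∈ L²` is then
automatic); values of `u` outside `[0, ℓ]` play no role. -/
structure IsH10 (ℓ : ℝ) (u g : ℝ → ℝ) : Prop where
  continuousOn : ContinuousOn u (Icc 0 ℓ)
  left_eq_zero : u 0 = 0
  right_eq_zero : u ℓ = 0
  memLp_deriv : MemLp g 2 (volume.restrict (Icc 0 ℓ))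
  hasWeakDeriv : HasWeakDeriv ℓ u g

/-- `u` is a nontrivial weak solution, in `H¹₀(0, ℓ)`, of
`-u'' = lam (m u⁺ - t n u⁻)` in `(0, ℓ)`, `u(0) = u(ℓ) = 0`. -/
def IsHalfEigenfunction (ℓ t : ℝ) (m n : ℝ → ℝ) (lam : ℝ) (u : ℝ → ℝ) : Prop :=
  (∃ x ∈ Icc 0 ℓ, u x ≠ 0) ∧
  ∃ g : ℝ → ℝ, IsH10 ℓ u g ∧
    ∀ v h : ℝ → ℝ, IsH10 ℓ v h →
      ∫ x in (0 : ℝ)..ℓ, g x * h x =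
        ∫ x in (0 : ℝ)..ℓ, lam * (m x * (u x)⁺ - t * n x * (u x)⁻) * v x

/-- The set `Σ_t^σ(m, n)` of half-eigenvalues that have a half-eigenfunction `u` whose slope
`u'(0)` has the sign of `σ`; it is used with `σ = 1` (for `Σ_t^+`) and `σ = -1` (for `Σ_t^-`).
Here `u'(0)` is the classical one-sided derivative. -/
def halfSpectrum (ℓ t : ℝ) (m n : ℝ → ℝ) (σ : ℝ) : Set ℝ :=
  {lam | ∃ (u : ℝ → ℝ) (c : ℝ), IsHalfEigenfunction ℓ t m n lam u ∧
    HasDerivWithinAt u c (Icc 0 ℓ) 0 ∧ 0 < σ * c}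

/-- The elements of a set of reals listed in increasing order, counting from zero: the least
element, the least element above it, and so on. -/
def nthSmallest (S : Set ℝ) : ℕ → ℝ
  | 0 => sInf S
  | k + 1 => sInf {x ∈ S | nthSmallest S k < x}

/-- The half-eigenvalues in `Σ_t^σ(m, n)` in increasing order. The index counts from zero, so
`halfEigenvalue ℓ t m n σ k` is the half-eigenvalue usually written `λ_{k+1,t}^σ`. -/
def halfEigenvalue (ℓ t : ℝ) (m n : ℝ → ℝ) (σ : ℝ) (k : ℕ) : ℝ :=
  nthSmallest (halfSpectrum ℓ t m n σ) k

/-- `s` is a strictly increasing enumeration of `S`, diverging to `+∞`. -/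
def IsIncreasingEnumeration (S : Set ℝ) (s : ℕ → ℝ) : Prop :=
  StrictMono s ∧ range s = S ∧ Tendsto s atTop atTop

end HalfEigen

end

/-! In polar coordinates `u = r sin θ`, `u' = r cos θ` (Prüfer), positive homogeneity removes `r`
from the equation of the angle: `θ' = cos² θ + λ (m (sin⁺ θ)² + t n (sin⁻ θ)²)`. The sign of `u'(0)`
selects the initial angle `θ₀ = 0` or `θ₀ = π`, and `λ` is a half-eigenvalue exactly when the end
angle `θ(ℓ)` is a multiple of `π` (`halfSpectrum_eq`).

By comparison (`lt_of_subsolution_supersolution`) the end angle increases strictly with `λ` and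
always exceeds `θ₀`. It is continuous in `λ`, lies below `θ₀ + π/2` at `λ = 0`, and is unbounded
above. So it takes each value `θ₀ + kπ`, `k ≥ 1`, exactly once and meets no other multiple of `π`;
these parameters enumerate the spectrum (`exists_endAngle_eq`).

For the limit, fix `λ` and insert the limiting angle into the perturbed equation. The weights enter
linearly, so the error consists of integrals of `m_ε - m₀` and `n_ε - n₀` against fixed continuous
functions. Weak* convergence makes it vanish, and Grönwall's inequality yields convergence of the
end angles (`IsAngle.tendsto_end`). Strict monotonicity in `λ` transfers this to the roots
(`tendsto_of_endAngle_eq`).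

The link with weak solutions is a regularity statement: by the du Bois-Reymond lemma, `u` and its
derivative are absolutely continuous and solve a first order system, whose solutions are unique. -/

namespace HalfEigen

/-! ### Calculus of absolutely continuous functions -/

/-- `F` is absolutely continuous on `[0, ℓ]` with integrable almost everywhere derivative `f`. -/
structure IsPrimitive (ℓ : ℝ) (F f : ℝ → ℝ) : Prop where
  ac : AbsolutelyContinuousOnInterval F 0 ℓ
  intervalIntegrable : IntervalIntegrable f volume 0 ℓ
  ae_hasDerivAt : ∀ᵐ x, x ∈ Ioo 0 ℓ → HasDerivAt F (f x) x

theorem absolutelyContinuousOnInterval_congr {F G : ℝ → ℝ} {a b : ℝ}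
    (hF : AbsolutelyContinuousOnInterval F a b) (h : EqOn F G (uIcc a b)) :
    AbsolutelyContinuousOnInterval G a b := by
  rw [absolutelyContinuousOnInterval_iff] at hF ⊢
  intro ε hε
  obtain ⟨δ, hδ, H⟩ := hF ε hε
  refine ⟨δ, hδ, fun E hE hE' => ?_⟩
  convert H E hE hE' using 1
  refine Finset.sum_congr rfl fun i hi => ?_
  rw [h (hE.1 i hi).1, h (hE.1 i hi).2]

/-- `F` is bounded on the interval, so only the Lipschitz constant of `φ` on a compact range
matters. -/
theorem absolutelyContinuousOnInterval_comp {F φ : ℝ → ℝ} {a b : ℝ}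
    (hF : AbsolutelyContinuousOnInterval F a b) (hφ : ContDiff ℝ 1 φ) :
    AbsolutelyContinuousOnInterval (fun x => φ (F x)) a b := by
  obtain ⟨C, hC⟩ := hF.exists_bound
  obtain ⟨K, hK⟩ := (hφ.contDiffOn (s := Icc (-C) C)).exists_lipschitzOnWith (by decide)
    (convex_Icc _ _) isCompact_Icc
  have hmem : ∀ x ∈ uIcc a b, F x ∈ Icc (-C) C := fun x hx => abs_le.1 (hC x hx)
  rw [absolutelyContinuousOnInterval_iff] at hF ⊢
  intro ε hε
  obtain ⟨δ, hδ, H⟩ := hF (ε / (K + 1)) (by positivity)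
  refine ⟨δ, hδ, fun E hE hE' => ?_⟩
  have h1 := H E hE hE'
  calc ∑ i ∈ Finset.range E.1, dist (φ (F (E.2 i).1)) (φ (F (E.2 i).2))
      ≤ ∑ i ∈ Finset.range E.1, K * dist (F (E.2 i).1) (F (E.2 i).2) := by
        refine Finset.sum_le_sum fun i hi => ?_
        exact hK.dist_le_mul _ (hmem _ (hE.1 i hi).1) _ (hmem _ (hE.1 i hi).2)
    _ = K * ∑ i ∈ Finset.range E.1, dist (F (E.2 i).1) (F (E.2 i).2) := by
        rw [Finset.mul_sum]
    _ ≤ K * (ε / (K + 1)) := by gcongr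
    _ < (K + 1) * (ε / (K + 1)) := by gcongr; linarith
    _ = ε := by field_simp

theorem intervalIntegrable_mono_Icc {f : ℝ → ℝ} {ℓ x : ℝ} (hf : IntervalIntegrable f volume 0 ℓ)
    (hx : x ∈ Icc 0 ℓ) : IntervalIntegrable f volume 0 x :=
  hf.mono_set (by rw [uIcc_of_le hx.1, uIcc_of_le (hx.1.trans hx.2)]; exact Icc_subset_Icc_right hx.2)

namespace IsPrimitive

variable {ℓ : ℝ} {F G f g : ℝ → ℝ}

theorem of_integral (hℓ : 0 ≤ ℓ) (hf : IntervalIntegrable f volume 0 ℓ) (c : ℝ)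
    (hF : ∀ x ∈ Icc 0 ℓ, F x = c + ∫ s in (0 : ℝ)..x, f s) : IsPrimitive ℓ F f := by
  refine ⟨?_, hf, ?_⟩
  · have h1 := hf.absolutelyContinuousOnInterval_intervalIntegral (c := 0) (by simp)
    have h2 : AbsolutelyContinuousOnInterval (fun _ : ℝ => c) 0 ℓ :=
      (contDiff_const (𝕜 := ℝ) (n := 1) (c := c)).contDiffOn.absolutelyContinuousOnInterval
    refine absolutelyContinuousOnInterval_congr (h2.add h1) ?_
    rw [uIcc_of_le hℓ]
    exact fun x hx => (hF x hx).symm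
  · filter_upwards [hf.ae_hasDerivAt_integral] with x hx hx'
    have hx2 : x ∈ uIcc 0 ℓ := by rw [uIcc_of_le hℓ]; exact Ioo_subset_Icc_self hx'
    refine ((hx hx2 0 (by simp)).const_add c).congr_of_eventuallyEq ?_
    filter_upwards [Icc_mem_nhds hx'.1 hx'.2] with y hy using hF y hy

theorem integral_sub (hF : IsPrimitive ℓ F f) {x y : ℝ} (hx : 0 ≤ x) (hxy : x ≤ y) (hy : y ≤ ℓ) :
    ∫ s in x..y, f s = F y - F x := by
  have hsub : uIcc x y ⊆ uIcc 0 ℓ := by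
    rw [uIcc_of_le hxy, uIcc_of_le (hx.trans (hxy.trans hy))]
    exact Icc_subset_Icc hx hy
  rw [← (hF.ac.mono hsub).integral_deriv_eq_sub, intervalIntegral.integral_of_le hxy,
    intervalIntegral.integral_of_le hxy, integral_Ioc_eq_integral_Ioo,
    integral_Ioc_eq_integral_Ioo]
  refine setIntegral_congr_ae measurableSet_Ioo ?_
  filter_upwards [hF.ae_hasDerivAt] with s hs hs'
  exact (hs ⟨hx.trans_lt hs'.1, hs'.2.trans_le hy⟩).deriv.symm

theorem eq_add_integral (hF : IsPrimitive ℓ F f) {x : ℝ} (hx : x ∈ Icc 0 ℓ) :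
    F x = F 0 + ∫ s in (0 : ℝ)..x, f s := by
  rw [hF.integral_sub le_rfl hx.1 hx.2]; ring

theorem continuousOn (hℓ : 0 ≤ ℓ) (hF : IsPrimitive ℓ F f) : ContinuousOn F (Icc 0 ℓ) := by
  have := hF.ac.continuousOn
  rwa [uIcc_of_le hℓ] at this

theorem continuousOn_uIcc (hF : IsPrimitive ℓ F f) : ContinuousOn F (uIcc 0 ℓ) :=
  hF.ac.continuousOn

theorem sub (hF : IsPrimitive ℓ F f) (hG : IsPrimitive ℓ G g) :
    IsPrimitive ℓ (fun x => F x - G x) (fun x => f x - g x) := by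
  refine ⟨hF.ac.sub hG.ac, hF.intervalIntegrable.sub hG.intervalIntegrable, ?_⟩
  filter_upwards [hF.ae_hasDerivAt, hG.ae_hasDerivAt] with x h1 h2 hx
  exact (h1 hx).sub (h2 hx)

theorem mul (hF : IsPrimitive ℓ F f) (hG : IsPrimitive ℓ G g) :
    IsPrimitive ℓ (fun x => F x * G x) (fun x => f x * G x + F x * g x) := by
  refine ⟨hF.ac.mul hG.ac, (hF.intervalIntegrable.mul_continuousOn hG.continuousOn_uIcc).add
    (hG.intervalIntegrable.continuousOn_mul hF.continuousOn_uIcc), ?_⟩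
  filter_upwards [hF.ae_hasDerivAt, hG.ae_hasDerivAt] with x h1 h2 hx
  exact (h1 hx).mul (h2 hx)

theorem comp (hF : IsPrimitive ℓ F f) {φ φ' : ℝ → ℝ} (hφ : ∀ y, HasDerivAt φ (φ' y) y)
    (hφ' : Continuous φ') :
    IsPrimitive ℓ (fun x => φ (F x)) (fun x => φ' (F x) * f x) := by
  have hd : deriv φ = φ' := funext fun y => (hφ y).deriv
  have h1 : ContDiff ℝ 1 φ :=
    contDiff_one_iff_deriv.2 ⟨fun y => (hφ y).differentiableAt, by rwa [hd]⟩
  refine ⟨absolutelyContinuousOnInterval_comp hF.ac h1,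
    hF.intervalIntegrable.continuousOn_mul (hφ'.comp_continuousOn hF.continuousOn_uIcc), ?_⟩
  filter_upwards [hF.ae_hasDerivAt] with x h hx
  exact (hφ (F x)).comp x (h hx)

theorem of_contDiff (hF : ContDiff ℝ 1 F) : IsPrimitive ℓ F (deriv F) :=
  ⟨hF.contDiffOn.absolutelyContinuousOnInterval,
    (hF.continuous_deriv le_rfl).intervalIntegrable _ _,
    ae_of_all _ fun x _ => (hF.differentiable (by decide) x).hasDerivAt⟩

theorem const (c : ℝ) : IsPrimitive ℓ (fun _ => c) (fun _ => 0) := by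
  have := of_contDiff (ℓ := ℓ) (contDiff_const (𝕜 := ℝ) (n := 1) (c := c) (E := ℝ))
  simpa using this

theorem congr_ae (hF : IsPrimitive ℓ F f) (hg : IntervalIntegrable g volume 0 ℓ)
    (h : ∀ᵐ x, x ∈ Ioo 0 ℓ → f x = g x) : IsPrimitive ℓ F g := by
  refine ⟨hF.ac, hg, ?_⟩
  filter_upwards [hF.ae_hasDerivAt, h] with x h1 h2 hx
  rw [← h2 hx]; exact h1 hx

theorem integral_mul_add (hℓ : 0 ≤ ℓ) (hF : IsPrimitive ℓ F f) (hG : IsPrimitive ℓ G g) :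
    ∫ x in (0 : ℝ)..ℓ, F x * g x = F ℓ * G ℓ - F 0 * G 0 - ∫ x in (0 : ℝ)..ℓ, f x * G x := by
  rw [← (hF.mul hG).integral_sub le_rfl hℓ le_rfl, intervalIntegral.integral_add
    (hF.intervalIntegrable.mul_continuousOn hG.continuousOn_uIcc)
    (hG.intervalIntegrable.continuousOn_mul hF.continuousOn_uIcc)]
  ring

/-- The variation of constants formula for `w' = A w + h`. -/
theorem exists_integratingFactor {w A h : ℝ → ℝ} (hℓ : 0 ≤ ℓ)
    (hA : IntervalIntegrable A volume 0 ℓ)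
    (hw : IsPrimitive ℓ w (fun x => A x * w x + h x)) :
    ∃ E : ℝ → ℝ, ContinuousOn E (Icc 0 ℓ) ∧ (∀ x, 0 < E x) ∧
      ∀ x ∈ Icc 0 ℓ, E x * w x = w 0 + ∫ s in (0 : ℝ)..x, E s * h s := by
  have hI : IsPrimitive ℓ (fun x => ∫ s in (0 : ℝ)..x, A s) A :=
    of_integral hℓ hA 0 (by simp)
  have hE := hI.comp (φ := fun y => Real.exp (-y)) (φ' := fun y => -Real.exp (-y))
    (fun y => by simpa using (hasDerivAt_neg y).exp) (by fun_prop)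
  refine ⟨fun x => Real.exp (-∫ s in (0 : ℝ)..x, A s), hE.continuousOn hℓ,
    fun x => Real.exp_pos _, fun x hx => ?_⟩
  have h1 := (hE.mul hw).eq_add_integral hx
  simp only [intervalIntegral.integral_same, neg_zero, Real.exp_zero, one_mul] at h1
  rw [h1]
  congr 2
  ext s
  ring

end IsPrimitive

/-! ### Grönwall, existence and comparison for scalar Carathéodory equations -/

/-- The derivative of `exp (-K x) * ∫ d` is at most `r`. The bound uses `r` only through its
integral and its value at `ℓ`, so no uniform smallness of `r` is needed later. -/
theorem gronwall_integral {ℓ K : ℝ} (hℓ : 0 ≤ ℓ) (hK : 0 ≤ K) {d r : ℝ → ℝ}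
    (hd : IntervalIntegrable d volume 0 ℓ) (hr : IntervalIntegrable r volume 0 ℓ)
    (hr0 : ∀ x ∈ Icc 0 ℓ, 0 ≤ r x)
    (h : ∀ x ∈ Icc 0 ℓ, d x ≤ r x + K * ∫ s in (0 : ℝ)..x, d s) :
    d ℓ ≤ r ℓ + K * (Real.exp (K * ℓ) * ∫ s in (0 : ℝ)..ℓ, r s) := by
  have hD : IsPrimitive ℓ (fun x => ∫ s in (0 : ℝ)..x, d s) d :=
    IsPrimitive.of_integral hℓ hd 0 (by simp)
  have hE := IsPrimitive.of_contDiff (ℓ := ℓ) (F := fun x => Real.exp (-(K * x))) (by fun_prop)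
  have hM := hE.mul hD
  have hderiv : ∀ x, deriv (fun x => Real.exp (-(K * x))) x = -K * Real.exp (-(K * x)) := by
    intro x
    have h : HasDerivAt (fun x => Real.exp (-(K * x))) (Real.exp (-(K * x)) * -(K * 1)) x :=
      ((hasDerivAt_id' x).const_mul K).fun_neg.exp
    rw [h.deriv]
    ring
  have h1 := hM.eq_add_integral (right_mem_Icc.2 hℓ)
  simp only [intervalIntegral.integral_same, mul_zero, zero_add] at h1
  have h2 : ∫ s in (0 : ℝ)..ℓ, (deriv (fun x => Real.exp (-(K * x))) s * (∫ s in (0 : ℝ)..s, d s)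
      + Real.exp (-(K * s)) * d s) ≤ ∫ s in (0 : ℝ)..ℓ, r s := by
    refine intervalIntegral.integral_mono_on hℓ hM.intervalIntegrable hr fun x hx => ?_
    rw [hderiv]
    have h3 := h x hx
    have h4 : Real.exp (-(K * x)) ≤ 1 := Real.exp_le_one_iff.2 (by
      have := mul_nonneg hK hx.1; linarith)
    have h5 := hr0 x hx
    calc _ = Real.exp (-(K * x)) * (d x - K * ∫ s in (0 : ℝ)..x, d s) := by ring
      _ ≤ Real.exp (-(K * x)) * r x := by gcongr; linarith
      _ ≤ r x := by nlinarith [Real.exp_pos (-(K * x))]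
  rw [← h1] at h2
  have h6 : (∫ s in (0 : ℝ)..ℓ, d s) ≤ Real.exp (K * ℓ) * ∫ s in (0 : ℝ)..ℓ, r s := by
    calc (∫ s in (0 : ℝ)..ℓ, d s)
        = Real.exp (K * ℓ) * (Real.exp (-(K * ℓ)) * ∫ s in (0 : ℝ)..ℓ, d s) := by
          rw [← mul_assoc, ← Real.exp_add]; simp
      _ ≤ _ := by gcongr
  have := h ℓ (right_mem_Icc.2 hℓ)
  have := mul_le_mul_of_nonneg_left h6 hK
  linarith

/-- Global existence for a scalar Carathéodory equation with bounded, uniformly Lipschitz right-hand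
side. -/
theorem exists_caratheodory_solution {ℓ L C : ℝ} (hℓ : 0 ≤ ℓ) (hL : 0 ≤ L) (f : ℝ → ℝ → ℝ)
    (hmeas : ∀ φ : ℝ → ℝ, Continuous φ → Measurable fun s => f s (φ s))
    (hC : ∀ s y, |f s y| ≤ C) (hLip : ∀ s y z, |f s y - f s z| ≤ L * |y - z|) (y₀ : ℝ) :
    ∃ θ : ℝ → ℝ, Continuous θ ∧
      ∀ x ∈ Icc 0 ℓ, θ x = y₀ + ∫ s in (0 : ℝ)..x, f s (θ s) := by
  have hint : ∀ φ : ℝ → ℝ, Continuous φ → ∀ a b : ℝ,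
      IntervalIntegrable (fun s => f s (φ s)) volume a b := fun φ hφ a b =>
    (intervalIntegrable_const (c := C)).mono_fun (hmeas φ hφ).aestronglyMeasurable
      (ae_of_all _ fun s => by
        simpa using (hC s (φ s)).trans (le_abs_self C))
  let T : C(Icc 0 ℓ, ℝ) → C(Icc 0 ℓ, ℝ) := fun φ =>
    ⟨fun x => y₀ + ∫ s in (0 : ℝ)..x, f s (IccExtend hℓ φ s),
      continuous_const.add ((intervalIntegral.continuous_primitive
        (hint _ φ.continuous.Icc_extend') 0).comp continuous_subtype_val)⟩
  -- Each Picard step integrates the previous bound, which produces the factorial. Some iterate of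
  -- `T` therefore contracts, however large `L * ℓ` is.
  have key : ∀ (φ ψ : C(Icc 0 ℓ, ℝ)) (n : ℕ) (x : Icc 0 ℓ),
      |(T^[n] φ) x - (T^[n] ψ) x| ≤ (L * x) ^ n / n.factorial * dist φ ψ := by
    intro φ ψ n
    induction n with
    | zero =>
      intro x
      simpa [Real.dist_eq] using ContinuousMap.dist_apply_le_dist (f := φ) (g := ψ) x
    | succ n ih =>
      intro x
      rw [Function.iterate_succ_apply', Function.iterate_succ_apply']
      set φ' := T^[n] φ
      set ψ' := T^[n] ψ
      have h1 : (T φ') x - (T ψ') x = ∫ s in (0 : ℝ)..x,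
          (f s (IccExtend hℓ φ' s) - f s (IccExtend hℓ ψ' s)) := by
        rw [intervalIntegral.integral_sub (hint _ φ'.continuous.Icc_extend' _ _)
          (hint _ ψ'.continuous.Icc_extend' _ _)]
        change (y₀ + _) - (y₀ + _) = _
        ring
      rw [h1]
      have h2 : |∫ s in (0 : ℝ)..x, (f s (IccExtend hℓ φ' s) - f s (IccExtend hℓ ψ' s))| ≤
          ∫ s in (0 : ℝ)..x, L * ((L * s) ^ n / n.factorial * dist φ ψ) := by
        rw [← Real.norm_eq_abs]
        refine intervalIntegral.norm_integral_le_of_norm_le x.2.1 ?_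
          (Continuous.intervalIntegrable (by fun_prop) _ _)
        refine ae_of_all _ fun s hs => ?_
        have hs' : s ∈ Icc 0 ℓ := ⟨hs.1.le, hs.2.trans x.2.2⟩
        rw [Real.norm_eq_abs]
        refine (hLip _ _ _).trans (mul_le_mul_of_nonneg_left ?_ hL)
        rw [IccExtend_of_mem _ _ hs', IccExtend_of_mem _ _ hs']
        exact ih ⟨s, hs'⟩
      refine h2.trans (le_of_eq ?_)
      have h3 : ∀ s : ℝ, L * ((L * s) ^ n / n.factorial * dist φ ψ) =
          (L ^ (n + 1) / n.factorial * dist φ ψ) * s ^ n := fun s => by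
        rw [mul_pow]; ring
      simp_rw [h3]
      rw [intervalIntegral.integral_const_mul, integral_pow, Nat.factorial_succ]
      push_cast
      field_simp
      ring
  obtain ⟨n, hn⟩ := ((FloorSemiring.tendsto_pow_div_factorial_atTop (L * ℓ)).eventually
    (gt_mem_nhds zero_lt_one)).exists
  have hK : (0 : ℝ) ≤ (L * ℓ) ^ n / n.factorial := by positivity
  have hcontr : ContractingWith ⟨_, hK⟩ (T^[n]) := by
    refine ⟨hn, LipschitzWith.of_dist_le_mul fun φ ψ => ?_⟩
    rw [ContinuousMap.dist_le (by positivity)]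
    intro x
    rw [Real.dist_eq]
    refine (key φ ψ n x).trans ?_
    have := x.2.1
    have := x.2.2
    change _ ≤ (L * ℓ) ^ n / n.factorial * dist φ ψ
    gcongr
  have : Nonempty C(Icc 0 ℓ, ℝ) := ⟨0⟩
  -- The unique fixed point of the iterate `T^[n]` is also fixed by `T`.
  have hfix := hcontr.isFixedPt_fixedPoint_iterate
  set φ := hcontr.fixedPoint (T^[n])
  refine ⟨IccExtend hℓ φ, φ.continuous.Icc_extend', fun x hx => ?_⟩
  have h4 : (T φ) ⟨x, hx⟩ = φ ⟨x, hx⟩ := by rw [hfix]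
  rw [IccExtend_of_mem _ _ hx, ← h4]
  rfl

/-- A strict comparison principle: `y` is a subsolution and `z` a supersolution of the equation
`θ' = f x θ`. -/
theorem lt_of_subsolution_supersolution {ℓ L : ℝ} (hℓ : 0 < ℓ) {f : ℝ → ℝ → ℝ}
    (hmeas : ∀ φ : ℝ → ℝ, Continuous φ → Measurable fun s => f s (φ s))
    (hLip : ∀ s y z, |f s y - f s z| ≤ L * |y - z|) {y z y' z' : ℝ → ℝ}
    (hyc : Continuous y) (hzc : Continuous z)
    (hy : IsPrimitive ℓ y y') (hz : IsPrimitive ℓ z z')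
    (hle : ∀ x ∈ Icc 0 ℓ, y' x - f x (y x) ≤ z' x - f x (z x)) (h0 : y 0 ≤ z 0)
    (hlt : y 0 < z 0 ∨
      0 < ∫ x in (0 : ℝ)..ℓ, ((z' x - f x (z x)) - (y' x - f x (y x)))) :
    y ℓ < z ℓ := by
  -- Linearisation by the difference quotient: `w = z - y` solves `w' = A w + h` with `|A| ≤ |L|`
  -- and `h ≥ 0` on the interval. Where `z = y` the quotient is `0` by convention, which is harmless
  -- because its numerator vanishes too.
  set A : ℝ → ℝ := fun x => (f x (z x) - f x (y x)) / (z x - y x)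
  set h : ℝ → ℝ := fun x => (z' x - f x (z x)) - (y' x - f x (y x))
  have hfd : Measurable fun x => f x (z x) - f x (y x) := (hmeas z hzc).sub (hmeas y hyc)
  have hA : ∀ x, A x * (z x - y x) = f x (z x) - f x (y x) := by
    intro x
    by_cases hxy : z x - y x = 0
    · have : z x = y x := by linarith
      simp [A, this]
    · exact div_mul_cancel₀ _ hxy
  have hAint : IntervalIntegrable A volume 0 ℓ := by
    refine (intervalIntegrable_const (c := L)).mono_fun
      (hfd.div (hzc.measurable.sub hyc.measurable)).aestronglyMeasurable
      (ae_of_all _ fun x => ?_)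
    simp only [A, Real.norm_eq_abs, abs_div]
    refine (div_le_of_le_mul₀ (abs_nonneg _) (abs_nonneg _) ?_)
    exact (hLip _ _ _).trans (by gcongr; exact le_abs_self L)
  have hw : IsPrimitive ℓ (fun x => z x - y x) (fun x => A x * (z x - y x) + h x) := by
    convert hz.sub hy using 2 with x
    rw [hA]; simp only [h]; ring
  have hhint : IntervalIntegrable h volume 0 ℓ := by
    have h1 := hw.intervalIntegrable.sub (hAint.mul_continuousOn
      (hzc.sub hyc).continuousOn)
    convert h1 using 2 with x
    simp
  obtain ⟨E, hEc, hEpos, hE⟩ := IsPrimitive.exists_integratingFactor hℓ.le hAint hw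
  have h1 := hE ℓ (right_mem_Icc.2 hℓ.le)
  have hEcu : ContinuousOn E (uIcc 0 ℓ) := by rwa [uIcc_of_le hℓ.le]
  have h2 : 0 < (z 0 - y 0) + ∫ s in (0 : ℝ)..ℓ, E s * h s := by
    have hnn : 0 ≤ ∫ s in (0 : ℝ)..ℓ, E s * h s :=
      intervalIntegral.integral_nonneg hℓ.le fun x hx =>
        mul_nonneg (hEpos x).le (sub_nonneg.2 (hle x hx))
    rcases hlt with hlt | hlt
    · linarith
    -- The integrating factor has a positive minimum, so positivity passes from `∫ h` to `∫ E h`.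
    · obtain ⟨x₀, hx₀, hmin⟩ := isCompact_Icc.exists_isMinOn (nonempty_Icc.2 hℓ.le) hEc
      have h3 : ∫ s in (0 : ℝ)..ℓ, E x₀ * h s ≤ ∫ s in (0 : ℝ)..ℓ, E s * h s :=
        intervalIntegral.integral_mono_on hℓ.le (hhint.const_mul _)
          (hhint.continuousOn_mul hEcu) fun x hx =>
            mul_le_mul_of_nonneg_right (hmin hx) (sub_nonneg.2 (hle x hx))
      rw [intervalIntegral.integral_const_mul] at h3
      have := mul_pos (hEpos x₀) hlt
      linarith
  rw [← h1] at h2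
  have := pos_of_mul_pos_right h2 (hEpos ℓ).le
  linarith

/-! ### The equation of the Prüfer angle -/

/-- A measurable weight with `α ≤ p ≤ β` everywhere. -/
structure IsWeight (α β : ℝ) (p : ℝ → ℝ) : Prop where
  measurable : Measurable p
  lower : ∀ x, α ≤ p x
  upper : ∀ x, p x ≤ β

/-- The right-hand side of the equation of the Prüfer angle of `-u'' = lam (p u⁺ - q u⁻)`. -/
noncomputable def angleField (lam : ℝ) (p q : ℝ → ℝ) (x y : ℝ) : ℝ :=
  Real.cos y ^ 2 + lam * (p x * (Real.sin y)⁺ ^ 2 + q x * (Real.sin y)⁻ ^ 2)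

/-- `θ` is the Prüfer angle on `[0, ℓ]` with initial value `θ₀`. -/
structure IsAngle (ℓ lam : ℝ) (p q : ℝ → ℝ) (θ₀ : ℝ) (θ : ℝ → ℝ) : Prop where
  continuous : Continuous θ
  eq_integral : ∀ x ∈ Icc 0 ℓ, θ x = θ₀ + ∫ s in (0 : ℝ)..x, angleField lam p q s (θ s)

theorem posPart_sq_add_negPart_sq (x : ℝ) : x⁺ ^ 2 + x⁻ ^ 2 = x ^ 2 := by
  rcases le_total 0 x with h | h
  · simp [posPart_eq_self.2 h, negPart_eq_zero.2 h]
  · simp [posPart_eq_zero.2 h, negPart_eq_neg.2 h]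

theorem abs_sq_posPart_sub_le {x y : ℝ} (hx : |x| ≤ 1) (hy : |y| ≤ 1) :
    |x⁺ ^ 2 - y⁺ ^ 2| ≤ 2 * |x - y| := by
  have h1 : |x⁺ - y⁺| ≤ |x - y| := abs_max_sub_max_le_abs x y 0
  have h2 : ∀ z : ℝ, |z| ≤ 1 → 0 ≤ z⁺ ∧ z⁺ ≤ 1 := fun z hz =>
    ⟨posPart_nonneg z, max_le (abs_le.1 hz).2 zero_le_one⟩
  have h3 : |x⁺ + y⁺| ≤ 2 := by
    rw [abs_of_nonneg (add_nonneg (h2 x hx).1 (h2 y hy).1)]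
    linarith [(h2 x hx).2, (h2 y hy).2]
  rw [sq_sub_sq, abs_mul]
  exact mul_le_mul h3 h1 (abs_nonneg _) (by norm_num)

theorem abs_sq_negPart_sub_le {x y : ℝ} (hx : |x| ≤ 1) (hy : |y| ≤ 1) :
    |x⁻ ^ 2 - y⁻ ^ 2| ≤ 2 * |x - y| := by
  have := abs_sq_posPart_sub_le (x := -x) (y := -y) (by rwa [abs_neg]) (by rwa [abs_neg])
  rwa [posPart_neg, posPart_neg, neg_sub_neg, abs_sub_comm y x] at this

section

variable {ℓ α β lam θ₀ : ℝ} {p q θ : ℝ → ℝ}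

theorem IsWeight.abs_le (hα : 0 ≤ α) (hp : IsWeight α β p) (x : ℝ) : |p x| ≤ β := by
  rw [abs_of_nonneg (hα.trans (hp.lower x))]; exact hp.upper x

theorem measurable_angleField (hp : IsWeight α β p) (hq : IsWeight α β q) {φ : ℝ → ℝ}
    (hφ : Continuous φ) : Measurable fun s => angleField lam p q s (φ s) := by
  have h1 : Measurable fun s => (Real.sin (φ s))⁺ :=
    ((Real.continuous_sin.comp hφ).sup continuous_const).measurable
  have h2 : Measurable fun s => (Real.sin (φ s))⁻ :=
    ((Real.continuous_sin.comp hφ).neg.sup continuous_const).measurable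
  have h3 : Measurable fun s => Real.cos (φ s) := (Real.continuous_cos.comp hφ).measurable
  exact (h3.pow_const 2).add (((hp.measurable.mul (h1.pow_const 2)).add
    (hq.measurable.mul (h2.pow_const 2))).const_mul lam)

theorem sin_sq_weight_le (hp : IsWeight α β p) (hq : IsWeight α β q) (x y : ℝ) :
    p x * (Real.sin y)⁺ ^ 2 + q x * (Real.sin y)⁻ ^ 2 ≤ β * Real.sin y ^ 2 := by
  rw [← posPart_sq_add_negPart_sq (Real.sin y), mul_add]
  gcongr
  · exact hp.upper x
  · exact hq.upper x

theorem le_sin_sq_weight (hp : IsWeight α β p) (hq : IsWeight α β q) (x y : ℝ) :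
    α * Real.sin y ^ 2 ≤ p x * (Real.sin y)⁺ ^ 2 + q x * (Real.sin y)⁻ ^ 2 := by
  rw [← posPart_sq_add_negPart_sq (Real.sin y), mul_add]
  gcongr
  · exact hp.lower x
  · exact hq.lower x

theorem abs_angleField_le (hα : 0 ≤ α) (hp : IsWeight α β p) (hq : IsWeight α β q) (x y : ℝ) :
    |angleField lam p q x y| ≤ 1 + |lam| * β := by
  have hβ : 0 ≤ β := hα.trans ((hp.lower x).trans (hp.upper x))
  have h1 : 0 ≤ p x * (Real.sin y)⁺ ^ 2 + q x * (Real.sin y)⁻ ^ 2 :=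
    le_trans (by positivity) (le_sin_sq_weight hp hq x y)
  have h2 : p x * (Real.sin y)⁺ ^ 2 + q x * (Real.sin y)⁻ ^ 2 ≤ β :=
    (sin_sq_weight_le hp hq x y).trans (by nlinarith [Real.sin_sq_le_one y])
  refine (abs_add_le _ _).trans (add_le_add ?_ ?_)
  · rw [abs_of_nonneg (sq_nonneg _)]; exact Real.cos_sq_le_one y
  · rw [abs_mul, abs_of_nonneg h1]; gcongr

theorem abs_angleField_sub_le (hα : 0 ≤ α) (hp : IsWeight α β p) (hq : IsWeight α β q)
    (x y z : ℝ) :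
    |angleField lam p q x y - angleField lam p q x z| ≤ (2 + 4 * (|lam| * β)) * |y - z| := by
  have hβ : 0 ≤ β := hα.trans ((hp.lower x).trans (hp.upper x))
  have hs : |Real.sin y - Real.sin z| ≤ |y - z| := by
    simpa [Real.dist_eq] using Real.lipschitzWith_sin.dist_le_mul y z
  have hc : |Real.cos y ^ 2 - Real.cos z ^ 2| ≤ 2 * |y - z| := by
    have h1 : |Real.cos y - Real.cos z| ≤ |y - z| := by
      simpa [Real.dist_eq] using Real.lipschitzWith_cos.dist_le_mul y z
    have h2 : |Real.cos y + Real.cos z| ≤ 2 := (abs_add_le _ _).trans (by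
      linarith [Real.abs_cos_le_one y, Real.abs_cos_le_one z])
    rw [sq_sub_sq, abs_mul]
    exact mul_le_mul h2 h1 (abs_nonneg _) (by norm_num)
  have h3 := (abs_sq_posPart_sub_le (Real.abs_sin_le_one y) (Real.abs_sin_le_one z)).trans
    (mul_le_mul_of_nonneg_left hs zero_le_two)
  have h4 := (abs_sq_negPart_sub_le (Real.abs_sin_le_one y) (Real.abs_sin_le_one z)).trans
    (mul_le_mul_of_nonneg_left hs zero_le_two)
  have h5 : |p x * ((Real.sin y)⁺ ^ 2 - (Real.sin z)⁺ ^ 2)| ≤ β * (2 * |y - z|) := by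
    rw [abs_mul]
    exact mul_le_mul (hp.abs_le hα x) h3 (abs_nonneg _) hβ
  have h6 : |q x * ((Real.sin y)⁻ ^ 2 - (Real.sin z)⁻ ^ 2)| ≤ β * (2 * |y - z|) := by
    rw [abs_mul]
    exact mul_le_mul (hq.abs_le hα x) h4 (abs_nonneg _) hβ
  calc |angleField lam p q x y - angleField lam p q x z|
      = |(Real.cos y ^ 2 - Real.cos z ^ 2) +
          lam * (p x * ((Real.sin y)⁺ ^ 2 - (Real.sin z)⁺ ^ 2) +
            q x * ((Real.sin y)⁻ ^ 2 - (Real.sin z)⁻ ^ 2))| := by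
        congr 1; simp only [angleField]; ring
    _ ≤ 2 * |y - z| + |lam| * (β * (2 * |y - z|) + β * (2 * |y - z|)) := by
        refine (abs_add_le _ _).trans (add_le_add hc ?_)
        rw [abs_mul]
        gcongr
        exact (abs_add_le _ _).trans (add_le_add h5 h6)
    _ = _ := by ring

theorem intervalIntegrable_of_abs_le {f : ℝ → ℝ} {C : ℝ} (hf : Measurable f)
    (hC : ∀ x, |f x| ≤ C) (a b : ℝ) : IntervalIntegrable f volume a b :=
  (intervalIntegrable_const (c := C)).mono_fun hf.aestronglyMeasurable
    (ae_of_all _ fun s => by simpa using (hC s).trans (le_abs_self C))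

theorem intervalIntegrable_angleField (hα : 0 ≤ α) (hp : IsWeight α β p) (hq : IsWeight α β q)
    {φ : ℝ → ℝ} (hφ : Continuous φ) (a b : ℝ) :
    IntervalIntegrable (fun s => angleField lam p q s (φ s)) volume a b :=
  intervalIntegrable_of_abs_le (measurable_angleField hp hq hφ)
    (fun _ => abs_angleField_le hα hp hq _ _) a b

theorem exists_isAngle (hℓ : 0 ≤ ℓ) (hα : 0 ≤ α) (hp : IsWeight α β p) (hq : IsWeight α β q)
    (lam θ₀ : ℝ) : ∃ θ, IsAngle ℓ lam p q θ₀ θ := by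
  have hβ : 0 ≤ β := hα.trans ((hp.lower 0).trans (hp.upper 0))
  obtain ⟨θ, h1, h2⟩ := exists_caratheodory_solution hℓ (L := 2 + 4 * (|lam| * β))
    (by positivity) (angleField lam p q) (fun _ hφ => measurable_angleField hp hq hφ)
    (abs_angleField_le hα hp hq) (abs_angleField_sub_le hα hp hq) θ₀
  exact ⟨θ, h1, h2⟩

/-- The value at `ℓ` of the Prüfer angle. -/
noncomputable def endAngle (ℓ lam : ℝ) (p q : ℝ → ℝ) (θ₀ : ℝ) : ℝ :=
  Classical.epsilon (IsAngle ℓ lam p q θ₀) ℓ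

theorem isAngle_epsilon (hℓ : 0 ≤ ℓ) (hα : 0 ≤ α) (hp : IsWeight α β p) (hq : IsWeight α β q)
    (lam θ₀ : ℝ) : IsAngle ℓ lam p q θ₀ (Classical.epsilon (IsAngle ℓ lam p q θ₀)) :=
  Classical.epsilon_spec (exists_isAngle hℓ hα hp hq lam θ₀)

namespace IsAngle

theorem isPrimitive (hℓ : 0 ≤ ℓ) (hα : 0 ≤ α) (hp : IsWeight α β p) (hq : IsWeight α β q)
    (hθ : IsAngle ℓ lam p q θ₀ θ) :
    IsPrimitive ℓ θ (fun s => angleField lam p q s (θ s)) :=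
  .of_integral hℓ (intervalIntegrable_angleField hα hp hq hθ.continuous _ _) θ₀ hθ.eq_integral

theorem apply_zero (hℓ : 0 ≤ ℓ) (hθ : IsAngle ℓ lam p q θ₀ θ) : θ 0 = θ₀ := by
  simpa using hθ.eq_integral 0 (left_mem_Icc.2 hℓ)

/-- At a zero of the sine the field equals `1` whatever `lam` is, so the constant `θ₀` is a strict
subsolution. -/
theorem lt_end (hℓ : 0 < ℓ) (hα : 0 ≤ α) (hp : IsWeight α β p) (hq : IsWeight α β q)
    (h0 : Real.sin θ₀ = 0) (hθ : IsAngle ℓ lam p q θ₀ θ) : θ₀ < θ ℓ := by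
  have hc : Real.cos θ₀ ^ 2 = 1 := by rw [Real.cos_sq', h0]; simp
  refine lt_of_subsolution_supersolution (f := angleField lam p q) hℓ
    (fun _ hφ => measurable_angleField hp hq hφ) (abs_angleField_sub_le hα hp hq)
    continuous_const hθ.continuous (IsPrimitive.const θ₀) (hθ.isPrimitive hℓ.le hα hp hq) ?_
    (hθ.apply_zero hℓ.le).ge (Or.inr ?_)
  · intro x _
    simp [angleField, h0, hc]
  · simp [angleField, h0, hc, hℓ]

/-- For `lam = 0` the field is `cos²`, and the constant `θ₀ + π / 2` is a solution that acts as a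
barrier. -/
theorem end_lt_of_lam_eq_zero (hℓ : 0 < ℓ) (hα : 0 ≤ α) (hp : IsWeight α β p)
    (hq : IsWeight α β q) (h0 : Real.sin θ₀ = 0) (hθ : IsAngle ℓ 0 p q θ₀ θ) :
    θ ℓ < θ₀ + Real.pi / 2 := by
  refine lt_of_subsolution_supersolution (f := angleField 0 p q) hℓ
    (fun _ hφ => measurable_angleField hp hq hφ) (abs_angleField_sub_le hα hp hq)
    hθ.continuous continuous_const (hθ.isPrimitive hℓ.le hα hp hq)
    (IsPrimitive.const (θ₀ + Real.pi / 2)) ?_ ?_ (Or.inl ?_)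
  · intro x _
    simp [angleField, Real.cos_add_pi_div_two, h0]
  · rw [hθ.apply_zero hℓ.le]; linarith [Real.pi_pos]
  · rw [hθ.apply_zero hℓ.le]; linarith [Real.pi_pos]

/-- If the sine vanished throughout, the field would be `1` and `θ = θ₀ + x`; but then the sine is
nonzero at `min ℓ 1`, which lies in `(0, π)`. -/
theorem exists_sin_ne_zero (hℓ : 0 < ℓ) (h0 : Real.sin θ₀ = 0)
    (hθ : IsAngle ℓ lam p q θ₀ θ) : ∃ x ∈ Icc 0 ℓ, Real.sin (θ x) ≠ 0 := by
  by_contra! h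
  have hc : Real.cos θ₀ ≠ 0 := fun hc => by
    have := Real.sin_sq_add_cos_sq θ₀
    rw [h0, hc] at this; norm_num at this
  have hx : min ℓ 1 ∈ Icc 0 ℓ := ⟨le_min hℓ.le zero_le_one, min_le_left _ _⟩
  have h1 : θ (min ℓ 1) = θ₀ + min ℓ 1 := by
    rw [hθ.eq_integral _ hx]
    congr 1
    rw [intervalIntegral.integral_congr (g := fun _ => 1)]
    · simp
    · intro s hs
      rw [uIcc_of_le hx.1] at hs
      have h2 := h s ⟨hs.1, hs.2.trans hx.2⟩
      simp [angleField, h2, Real.cos_sq']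
  have h2 := h _ hx
  rw [h1, Real.sin_add, h0, zero_mul, zero_add] at h2
  have h3 : 0 < Real.sin (min ℓ 1) := Real.sin_pos_of_pos_of_lt_pi (lt_min hℓ one_pos)
    ((min_le_right _ _).trans_lt (by linarith [Real.pi_gt_three]))
  exact (mul_ne_zero hc h3.ne') h2

/-- The angle for `lam` is a subsolution of the equation for `lam'`, with a gap of at least `(lam' -
lam) * α * sin² θ`. This gap has positive integral since `sin θ` is not identically zero. -/
theorem end_lt_end {lam' : ℝ} {θ' : ℝ → ℝ} (hℓ : 0 < ℓ) (hα : 0 < α) (hp : IsWeight α β p)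
    (hq : IsWeight α β q) (h0 : Real.sin θ₀ = 0) (hθ : IsAngle ℓ lam p q θ₀ θ)
    (hθ' : IsAngle ℓ lam' p q θ₀ θ') (hlam : lam < lam') : θ ℓ < θ' ℓ := by
  have hdiff : ∀ x y, angleField lam' p q x y - angleField lam p q x y =
      (lam' - lam) * (p x * (Real.sin y)⁺ ^ 2 + q x * (Real.sin y)⁻ ^ 2) := fun x y => by
    simp only [angleField]; ring
  have hlow : ∀ x, (lam' - lam) * (α * Real.sin (θ x) ^ 2) ≤
      angleField lam' p q x (θ x) - angleField lam p q x (θ x) := fun x => by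
    rw [hdiff]
    exact mul_le_mul_of_nonneg_left (le_sin_sq_weight hp hq _ _) (sub_pos.2 hlam).le
  have hnn : ∀ x, 0 ≤ (lam' - lam) * (α * Real.sin (θ x) ^ 2) := fun x => by
    have := sub_pos.2 hlam
    positivity
  refine lt_of_subsolution_supersolution (f := angleField lam' p q) hℓ
    (fun _ hφ => measurable_angleField hp hq hφ) (abs_angleField_sub_le hα.le hp hq)
    hθ.continuous hθ'.continuous (hθ.isPrimitive hℓ.le hα.le hp hq)
    (hθ'.isPrimitive hℓ.le hα.le hp hq) ?_ ?_ (Or.inr ?_)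
  · intro x _
    linarith [hlow x, hnn x]
  · rw [hθ.apply_zero hℓ.le, hθ'.apply_zero hℓ.le]
  · have hcont : Continuous fun x => (lam' - lam) * (α * Real.sin (θ x) ^ 2) := by
      have := hθ.continuous
      fun_prop
    have hpos : 0 < ∫ x in (0 : ℝ)..ℓ, (lam' - lam) * (α * Real.sin (θ x) ^ 2) := by
      refine intervalIntegral.integral_pos hℓ hcont.continuousOn (fun x _ => hnn x) ?_
      obtain ⟨x, hx, hx'⟩ := hθ.exists_sin_ne_zero hℓ h0
      have := sub_pos.2 hlam
      exact ⟨x, hx, by positivity⟩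
    refine hpos.trans_le (intervalIntegral.integral_mono_on hℓ.le
      (hcont.intervalIntegrable _ _) ?_ fun x _ => ?_)
    · exact ((intervalIntegrable_angleField hα.le hp hq hθ'.continuous _ _).sub
        (intervalIntegrable_angleField hα.le hp hq hθ'.continuous _ _)).sub
        ((intervalIntegrable_angleField hα.le hp hq hθ.continuous _ _).sub
        (intervalIntegrable_angleField hα.le hp hq hθ.continuous _ _))
    · linarith [hlow x]

end IsAngle

end

/-! ### Continuous dependence on the parameter and the weights -/

/-- Continuous dependence of the Prüfer angle on the spectral parameter and, in the weak* sense, on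
the weights. -/
theorem IsAngle.tendsto_end {ι : Type*} {l : Filter ι} [l.IsCountablyGenerated]
    {ℓ α β lam θ₀ : ℝ} {lams : ι → ℝ} {p q θ : ℝ → ℝ} {ps qs θs : ι → ℝ → ℝ}
    (hℓ : 0 ≤ ℓ) (hα : 0 ≤ α) (hp : IsWeight α β p) (hq : IsWeight α β q)
    (hps : ∀ i, IsWeight α β (ps i)) (hqs : ∀ i, IsWeight α β (qs i))
    (hlam : Tendsto lams l (𝓝 lam))
    (hplim : ∀ f : ℝ → ℝ, Continuous f → ∀ x ∈ Icc 0 ℓ,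
      Tendsto (fun i => ∫ s in (0 : ℝ)..x, ps i s * f s) l (𝓝 (∫ s in (0 : ℝ)..x, p s * f s)))
    (hqlim : ∀ f : ℝ → ℝ, Continuous f → ∀ x ∈ Icc 0 ℓ,
      Tendsto (fun i => ∫ s in (0 : ℝ)..x, qs i s * f s) l (𝓝 (∫ s in (0 : ℝ)..x, q s * f s)))
    (hθ : IsAngle ℓ lam p q θ₀ θ) (hθs : ∀ i, IsAngle ℓ (lams i) (ps i) (qs i) θ₀ (θs i)) :
    Tendsto (fun i => θs i ℓ) l (𝓝 (θ ℓ)) := by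
  have hβ : 0 ≤ β := hα.trans ((hp.lower 0).trans (hp.upper 0))
  -- The residual of the limiting angle in the perturbed equation. Both fields are evaluated along
  -- the fixed `θ`, so the varying weights meet only fixed continuous functions.
  set R : ι → ℝ → ℝ := fun i x => ∫ s in (0 : ℝ)..x,
    (angleField (lams i) (ps i) (qs i) s (θ s) - angleField lam p q s (θ s)) with hR
  -- Eventually `|lams i| ≤ |lam| + 1`, so the Lipschitz constant `K` and the bound `C` do not
  -- depend on `i`.
  set K : ℝ := 2 + 4 * ((|lam| + 1) * β)
  have hK : 0 ≤ K := by positivity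
  set C : ℝ := 1 + (|lam| + 1) * β
  have hint : ∀ i (φ : ℝ → ℝ), Continuous φ → ∀ a b, IntervalIntegrable
      (fun s => angleField (lams i) (ps i) (qs i) s (φ s)) volume a b := fun i φ hφ a b =>
    intervalIntegrable_angleField hα (hps i) (hqs i) hφ a b
  have hint0 : ∀ a b, IntervalIntegrable
      (fun s => angleField lam p q s (θ s)) volume a b := fun a b =>
    intervalIntegrable_angleField hα hp hq hθ.continuous a b
  have hlam' : ∀ᶠ i in l, |lams i| ≤ |lam| + 1 :=
    (hlam.abs.eventually (gt_mem_nhds (lt_add_one |lam|))).mono fun i hi => hi.le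
  have hRcont : ∀ i, Continuous (R i) := fun i =>
    intervalIntegral.continuous_primitive (fun a b => (hint i θ hθ.continuous a b).sub (hint0 a b)) 0
  have hRlim : ∀ x ∈ Icc 0 ℓ, Tendsto (fun i => R i x) l (𝓝 0) := by
    intro x hx
    have hf : Continuous fun s => (Real.sin (θ s))⁺ ^ 2 :=
      (((Real.continuous_sin.comp hθ.continuous).sup continuous_const).pow 2)
    have hg : Continuous fun s => (Real.sin (θ s))⁻ ^ 2 :=
      (((Real.continuous_sin.comp hθ.continuous).neg.sup continuous_const).pow 2)
    have hwi : ∀ {w f : ℝ → ℝ}, IsWeight α β w → Continuous f →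
        IntervalIntegrable (fun s => w s * f s) volume 0 x := fun hw hf =>
      (intervalIntegrable_of_abs_le hw.measurable (hw.abs_le hα) 0 x).mul_continuousOn
        hf.continuousOn
    have hRx : ∀ i, R i x =
        lams i * ((∫ s in (0 : ℝ)..x, ps i s * (Real.sin (θ s))⁺ ^ 2) +
          ∫ s in (0 : ℝ)..x, qs i s * (Real.sin (θ s))⁻ ^ 2) -
        lam * ((∫ s in (0 : ℝ)..x, p s * (Real.sin (θ s))⁺ ^ 2) +
          ∫ s in (0 : ℝ)..x, q s * (Real.sin (θ s))⁻ ^ 2) := by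
      intro i
      rw [← intervalIntegral.integral_add (hwi (hps i) hf) (hwi (hqs i) hg),
        ← intervalIntegral.integral_add (hwi hp hf) (hwi hq hg),
        ← intervalIntegral.integral_const_mul, ← intervalIntegral.integral_const_mul,
        ← intervalIntegral.integral_sub (((hwi (hps i) hf).add (hwi (hqs i) hg)).const_mul _)
          (((hwi hp hf).add (hwi hq hg)).const_mul _)]
      simp only [hR, angleField]
      congr 1
      ext s
      ring
    simp_rw [hRx]
    have := (hlam.mul ((hplim _ hf x hx).add (hqlim _ hg x hx))).sub_const
      (lam * ((∫ s in (0 : ℝ)..x, p s * (Real.sin (θ s))⁺ ^ 2) +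
          ∫ s in (0 : ℝ)..x, q s * (Real.sin (θ s))⁻ ^ 2))
    rwa [sub_self] at this
  have hRint : Tendsto (fun i => ∫ x in (0 : ℝ)..ℓ, |R i x|) l (𝓝 0) := by
    have := intervalIntegral.tendsto_integral_filter_of_dominated_convergence
      (μ := volume) (a := 0) (b := ℓ) (F := fun i x => |R i x|) (f := fun _ => (0 : ℝ)) (l := l)
      (fun _ => (C + C) * ℓ) (Eventually.of_forall fun i => (hRcont i).abs.aestronglyMeasurable)
      ?_ intervalIntegrable_const ?_
    · simpa using this
    · filter_upwards [hlam'] with i hi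
      refine ae_of_all _ fun x hx => ?_
      rw [uIoc_of_le hℓ] at hx
      rw [Real.norm_eq_abs, abs_abs, ← Real.norm_eq_abs]
      refine (intervalIntegral.norm_integral_le_of_norm_le_const (C := C + C) fun s _ => ?_).trans ?_
      · rw [Real.norm_eq_abs]
        refine (abs_sub _ _).trans (add_le_add ?_ ?_)
        · refine (abs_angleField_le hα (hps i) (hqs i) _ _).trans ?_
          simp only [C]; gcongr
        · refine (abs_angleField_le hα hp hq _ _).trans ?_
          simp only [C]; gcongr; linarith
      · rw [sub_zero, abs_of_pos hx.1]
        have : 0 ≤ C := by positivity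
        gcongr
        exact hx.2
    · refine ae_of_all _ fun x hx => ?_
      rw [uIoc_of_le hℓ] at hx
      simpa using (hRlim x ⟨hx.1.le, hx.2⟩).abs
  have hbound : ∀ᶠ i in l, |θs i ℓ - θ ℓ| ≤
      |R i ℓ| + K * (Real.exp (K * ℓ) * ∫ x in (0 : ℝ)..ℓ, |R i x|) := by
    filter_upwards [hlam'] with i hi
    have hdc : Continuous fun x => |θs i x - θ x| := ((hθs i).continuous.sub hθ.continuous).abs
    refine gronwall_integral (d := fun x => |θs i x - θ x|) (r := fun x => |R i x|) hℓ hK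
      (hdc.intervalIntegrable _ _) ((hRcont i).abs.intervalIntegrable _ _)
      (fun x _ => abs_nonneg _) fun x hx => ?_
    have h1 : θs i x - θ x = R i x + ∫ s in (0 : ℝ)..x,
        (angleField (lams i) (ps i) (qs i) s (θs i s) -
          angleField (lams i) (ps i) (qs i) s (θ s)) := by
      rw [(hθs i).eq_integral x hx, hθ.eq_integral x hx]
      simp only [hR]
      rw [intervalIntegral.integral_sub (hint i _ hθ.continuous _ _) (hint0 _ _),
        intervalIntegral.integral_sub (hint i _ (hθs i).continuous _ _)
          (hint i _ hθ.continuous _ _)]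
      ring
    rw [h1]
    refine (abs_add_le _ _).trans (add_le_add le_rfl ?_)
    rw [← intervalIntegral.integral_const_mul, ← Real.norm_eq_abs]
    refine intervalIntegral.norm_integral_le_of_norm_le hx.1 (ae_of_all _ fun s _ => ?_)
      ((hdc.const_mul K).intervalIntegrable _ _)
    rw [Real.norm_eq_abs]
    refine (abs_angleField_sub_le hα (hps i) (hqs i) _ _ _).trans ?_
    simp only [K]
    gcongr
  have hzero : Tendsto (fun i => |R i ℓ| + K * (Real.exp (K * ℓ) * ∫ x in (0 : ℝ)..ℓ, |R i x|)) l
      (𝓝 0) := by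
    simpa using (hRlim ℓ (right_mem_Icc.2 hℓ)).abs.add
      ((hRint.const_mul (Real.exp (K * ℓ))).const_mul K)
  rw [tendsto_iff_dist_tendsto_zero]
  exact squeeze_zero' (Eventually.of_forall fun _ => dist_nonneg) hbound hzero

/-! ### Growth of the angle for large parameters -/

/-- The integral is the length over which the angle gains `π` for a constant weight. The integrand
is at most `1` for `Λ ≥ 1` and tends to `0` wherever the sine is nonzero. -/
theorem tendsto_integral_inv_cos_sq_add_mul_sin_sq :
    Tendsto (fun Λ : ℝ => ∫ y in (0 : ℝ)..Real.pi, (Real.cos y ^ 2 + Λ * Real.sin y ^ 2)⁻¹)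
      atTop (𝓝 0) := by
  have := intervalIntegral.tendsto_integral_filter_of_dominated_convergence
    (μ := volume) (a := 0) (b := Real.pi) (l := (atTop : Filter ℝ))
    (F := fun Λ y => (Real.cos y ^ 2 + Λ * Real.sin y ^ 2)⁻¹) (f := fun _ => (0 : ℝ))
    (fun _ => (1 : ℝ)) ?_ ?_ intervalIntegrable_const ?_
  · simpa using this
  · refine Eventually.of_forall fun Λ => Measurable.aestronglyMeasurable ?_
    exact Continuous.measurable (f := fun y => Real.cos y ^ 2 + Λ * Real.sin y ^ 2)
      (by fun_prop) |>.inv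
  · filter_upwards [eventually_ge_atTop 1] with Λ hΛ
    refine ae_of_all _ fun y _ => ?_
    have h1 : 1 ≤ Real.cos y ^ 2 + Λ * Real.sin y ^ 2 := by
      nlinarith [Real.sin_sq_add_cos_sq y, sq_nonneg (Real.sin y)]
    rw [Real.norm_eq_abs, abs_of_nonneg (inv_nonneg.2 (zero_le_one.trans h1))]
    exact inv_le_one_of_one_le₀ h1
  · have hpi : ∀ᵐ y : ℝ, y ≠ Real.pi := by simp [ae_iff, measure_singleton]
    filter_upwards [hpi] with y hy hy'
    rw [uIoc_of_le Real.pi_pos.le] at hy'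
    have hs : 0 < Real.sin y := Real.sin_pos_of_pos_of_lt_pi hy'.1 (lt_of_le_of_ne hy'.2 hy)
    refine Tendsto.inv_tendsto_atTop (tendsto_atTop_add_const_left _ _ ?_)
    exact tendsto_id.atTop_mul_const (by positivity)

section

variable {ℓ α β lam θ₀ : ℝ} {p q θ : ℝ → ℝ}

/-- With `G` a primitive of `g`, the lower bound on the weights gives `(G ∘ θ)' ≥ 1`, hence `ℓ ≤ ∫
g` over `[θ₀, θ ℓ]`. As `g` is `π`-periodic, a gain of at most `k * π` would force `ℓ ≤ k * ∫ g`
over one period. -/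
theorem IsAngle.lt_end_of_integral_lt (hℓ : 0 < ℓ) (hα : 0 < α) (hp : IsWeight α β p)
    (hq : IsWeight α β q) (hlam : 0 < lam) (hθ : IsAngle ℓ lam p q θ₀ θ) (k : ℕ)
    (hk : k * (∫ y in (0 : ℝ)..Real.pi, (Real.cos y ^ 2 + (lam * α) * Real.sin y ^ 2)⁻¹) < ℓ) :
    θ₀ + k * Real.pi < θ ℓ := by
  set g : ℝ → ℝ := fun y => (Real.cos y ^ 2 + (lam * α) * Real.sin y ^ 2)⁻¹ with hg
  have hpos : ∀ y, 0 < Real.cos y ^ 2 + (lam * α) * Real.sin y ^ 2 := fun y => by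
    by_cases hs : Real.sin y = 0
    · have := Real.sin_sq_add_cos_sq y
      rw [hs] at this ⊢
      linarith
    · have := sq_nonneg (Real.cos y)
      positivity
  have hgc : Continuous g := Continuous.inv₀ (by fun_prop) fun y => (hpos y).ne'
  have hgper : Function.Periodic g Real.pi := fun y => by
    simp [hg, Real.cos_add_pi, Real.sin_add_pi]
  have hG : ∀ y, HasDerivAt (fun y => ∫ s in (0 : ℝ)..y, g s) (g y) y := fun y =>
    hgc.integral_hasStrictDerivAt 0 y |>.hasDerivAt
  have hcomp := (hθ.isPrimitive hℓ.le hα.le hp hq).comp hG hgc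
  have h1 : ℓ ≤ ∫ s in θ₀..θ ℓ, g s := by
    have h2 := hcomp.integral_sub le_rfl hℓ.le le_rfl
    rw [intervalIntegral.integral_interval_sub_left (hgc.intervalIntegrable _ _)
      (hgc.intervalIntegrable _ _), hθ.apply_zero hℓ.le] at h2
    rw [← h2]
    calc ℓ = ∫ s in (0 : ℝ)..ℓ, (1 : ℝ) := by simp
      _ ≤ _ := intervalIntegral.integral_mono_on hℓ.le intervalIntegrable_const
        hcomp.intervalIntegrable fun s _ => ?_
    simp only [hg, angleField]
    rw [← div_eq_inv_mul, le_div_iff₀ (hpos _), one_mul, mul_assoc]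
    gcongr
    exact le_sin_sq_weight hp hq _ _
  by_contra! hle
  have h3 : ∫ s in θ₀..θ ℓ, g s ≤ ∫ s in θ₀..θ₀ + k * Real.pi, g s := by
    rw [← intervalIntegral.integral_add_adjacent_intervals (b := θ ℓ) (c := θ₀ + k * Real.pi)
      (hgc.intervalIntegrable _ _) (hgc.intervalIntegrable _ _)]
    have := intervalIntegral.integral_nonneg hle (f := g) (μ := volume)
      fun s _ => (inv_pos.2 (hpos s)).le
    linarith
  have h4 := hgper.intervalIntegral_add_zsmul_eq k θ₀ fun a b => hgc.intervalIntegrable a b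
  rw [hgper.intervalIntegral_add_eq θ₀ 0, zero_add] at h4
  simp only [zsmul_eq_mul, Int.cast_natCast] at h4
  linarith

end

/-! ### Roots of the end angle and their convergence -/

section

variable {ℓ α β θ₀ : ℝ} {p q : ℝ → ℝ}

theorem endAngle_strictMono (hℓ : 0 < ℓ) (hα : 0 < α) (hp : IsWeight α β p)
    (hq : IsWeight α β q) (h0 : Real.sin θ₀ = 0) : StrictMono fun lam => endAngle ℓ lam p q θ₀ :=
  fun lam lam' h => (isAngle_epsilon hℓ.le hα.le hp hq lam θ₀).end_lt_end (ℓ := ℓ) hℓ hα hp hq h0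
    (isAngle_epsilon hℓ.le hα.le hp hq lam' θ₀) h

theorem endAngle_continuous (hℓ : 0 ≤ ℓ) (hα : 0 ≤ α) (hp : IsWeight α β p)
    (hq : IsWeight α β q) : Continuous fun lam => endAngle ℓ lam p q θ₀ :=
  continuous_iff_continuousAt.2 fun lam =>
    (isAngle_epsilon hℓ hα hp hq lam θ₀).tendsto_end (θs := fun lam' =>
      Classical.epsilon (IsAngle ℓ lam' p q θ₀)) (ps := fun _ => p) (qs := fun _ => q) hℓ hα hp hq
      (fun _ => hp) (fun _ => hq) tendsto_id (fun _ _ _ _ => tendsto_const_nhds)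
      (fun _ _ _ _ => tendsto_const_nhds) fun lam' => isAngle_epsilon hℓ hα hp hq lam' θ₀

theorem exists_lt_endAngle (hℓ : 0 < ℓ) (hα : 0 < α) (hp : IsWeight α β p)
    (hq : IsWeight α β q) (k : ℕ) : ∃ lam, θ₀ + k * Real.pi < endAngle ℓ lam p q θ₀ := by
  have h1 := (tendsto_integral_inv_cos_sq_add_mul_sin_sq.comp
    (tendsto_id.atTop_mul_const hα)).const_mul (k : ℝ)
  rw [mul_zero] at h1
  obtain ⟨lam, h2, h3⟩ := ((h1.eventually (gt_mem_nhds hℓ)).and (eventually_gt_atTop 0)).exists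
  exact ⟨lam, (isAngle_epsilon hℓ.le hα.le hp hq lam θ₀).lt_end_of_integral_lt hℓ hα hp hq h3 k h2⟩

/-- The parameters at which the end angle has reached a multiple of `π` form an increasing
sequence. -/
theorem exists_endAngle_eq (hℓ : 0 < ℓ) (hα : 0 < α) (hp : IsWeight α β p)
    (hq : IsWeight α β q) (h0 : Real.sin θ₀ = 0) :
    ∃ s : ℕ → ℝ, (∀ k, endAngle ℓ (s k) p q θ₀ = θ₀ + (k + 1 : ℕ) * Real.pi) ∧
      StrictMono s ∧ Tendsto s atTop atTop ∧
      range s = {lam | Real.sin (endAngle ℓ lam p q θ₀) = 0} := by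
  have hmono := endAngle_strictMono hℓ hα hp hq h0
  have hzero : endAngle ℓ 0 p q θ₀ < θ₀ + Real.pi / 2 :=
    (isAngle_epsilon hℓ.le hα.le hp hq 0 θ₀).end_lt_of_lam_eq_zero (ℓ := ℓ) hℓ hα.le hp hq h0
  have hpi := Real.pi_pos
  have hex : ∀ k : ℕ, ∃ lam, endAngle ℓ lam p q θ₀ = θ₀ + (k + 1 : ℕ) * Real.pi := fun k => by
    obtain ⟨M, hM⟩ := exists_lt_endAngle (θ₀ := θ₀) hℓ hα hp hq (k + 1)
    -- Intermediate value theorem: the parameter `0` lies below every target level, and `M` above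
    -- this one.
    refine mem_range_of_exists_le_of_exists_ge (endAngle_continuous hℓ.le hα.le hp hq)
      ⟨0, hzero.le.trans ?_⟩ ⟨M, hM.le⟩
    push_cast
    nlinarith [mul_nonneg k.cast_nonneg hpi.le]
  choose s hs using hex
  have hsmono : StrictMono s := fun i j hij => by
    rw [← hmono.lt_iff_lt]
    simp only [hs]
    gcongr
  refine ⟨s, hs, hsmono, ?_, ?_⟩
  · refine tendsto_atTop_atTop.2 fun M => ?_
    obtain ⟨k, hk⟩ := exists_nat_gt ((endAngle ℓ M p q θ₀ - θ₀) / Real.pi)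
    refine ⟨k, fun j hj => (hmono.lt_iff_lt.1 ?_).le⟩
    simp only [hs]
    rw [div_lt_iff₀ hpi] at hk
    have : (k : ℝ) ≤ j := by exact_mod_cast hj
    push_cast
    nlinarith
  · ext lam
    constructor
    · rintro ⟨k, rfl⟩
      rw [mem_ofPred_eq, hs, Real.sin_add_nat_mul_pi, h0, mul_zero]
    · intro h
      -- This excludes the levels `θ₀ + n * π` with `n ≤ 0`; the remaining ones are `n = k + 1`.
      have hgt : θ₀ < endAngle ℓ lam p q θ₀ :=
        (isAngle_epsilon hℓ.le hα.le hp hq lam θ₀).lt_end (ℓ := ℓ) hℓ hα.le hp hq h0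
      have h1 : Real.sin (endAngle ℓ lam p q θ₀ - θ₀) = 0 := by
        rw [Real.sin_sub, h0, show Real.sin (endAngle ℓ lam p q θ₀) = 0 from h]; simp
      obtain ⟨n, hn⟩ := Real.sin_eq_zero_iff.1 h1
      have hn0 : 0 < n := by
        have : 0 < (n : ℝ) * Real.pi := by rw [hn]; linarith
        exact_mod_cast pos_of_mul_pos_left this hpi.le
      obtain ⟨k, rfl⟩ : ∃ k : ℕ, n = (k + 1 : ℕ) := ⟨(n - 1).toNat, by omega⟩
      refine ⟨k, hmono.injective ?_⟩
      simp only [hs]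
      push_cast at hn ⊢
      linarith

end

/-- A fixed `μ ≠ lam` has limiting end angle strictly on one side of `c`, and the perturbed end
angle at `μ` is eventually on the same side. Monotonicity then places `lams i` on the correct side
of `μ`, without any prior bound on `lams`. -/
theorem tendsto_of_endAngle_eq {ι : Type*} {l : Filter ι} [l.IsCountablyGenerated]
    {ℓ α β θ₀ lam c : ℝ} {lams : ι → ℝ} {p q : ℝ → ℝ} {ps qs : ι → ℝ → ℝ}
    (hℓ : 0 < ℓ) (hα : 0 < α) (hp : IsWeight α β p) (hq : IsWeight α β q)
    (hps : ∀ i, IsWeight α β (ps i)) (hqs : ∀ i, IsWeight α β (qs i))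
    (hplim : ∀ f : ℝ → ℝ, Continuous f → ∀ x ∈ Icc 0 ℓ,
      Tendsto (fun i => ∫ s in (0 : ℝ)..x, ps i s * f s) l (𝓝 (∫ s in (0 : ℝ)..x, p s * f s)))
    (hqlim : ∀ f : ℝ → ℝ, Continuous f → ∀ x ∈ Icc 0 ℓ,
      Tendsto (fun i => ∫ s in (0 : ℝ)..x, qs i s * f s) l (𝓝 (∫ s in (0 : ℝ)..x, q s * f s)))
    (h0 : Real.sin θ₀ = 0) (hlam : endAngle ℓ lam p q θ₀ = c)
    (hlams : ∀ i, endAngle ℓ (lams i) (ps i) (qs i) θ₀ = c) : Tendsto lams l (𝓝 lam) := by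
  have hlim : ∀ μ, Tendsto (fun i => endAngle ℓ μ (ps i) (qs i) θ₀) l
      (𝓝 (endAngle ℓ μ p q θ₀)) := fun μ =>
    (isAngle_epsilon hℓ.le hα.le hp hq μ θ₀).tendsto_end (ℓ := ℓ) hℓ.le hα.le hp hq hps hqs
      tendsto_const_nhds hplim hqlim (θs := fun i =>
        Classical.epsilon (IsAngle ℓ μ (ps i) (qs i) θ₀))
      fun i => isAngle_epsilon hℓ.le hα.le (hps i) (hqs i) μ θ₀
  have hmono := endAngle_strictMono hℓ hα hp hq h0
  have hmonos := fun i => endAngle_strictMono hℓ hα (hps i) (hqs i) h0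
  refine tendsto_order.2 ⟨fun μ hμ => ?_, fun μ hμ => ?_⟩
  · have h1 : endAngle ℓ μ p q θ₀ < c := hlam ▸ hmono hμ
    filter_upwards [(hlim μ).eventually (gt_mem_nhds h1)] with i hi
    rw [← hlams i] at hi
    exact (hmonos i).lt_iff_lt.1 hi
  · have h1 : c < endAngle ℓ μ p q θ₀ := hlam ▸ hmono hμ
    filter_upwards [(hlim μ).eventually (lt_mem_nhds h1)] with i hi
    rw [← hlams i] at hi
    exact (hmonos i).lt_iff_lt.1 hi

/-! ### The du Bois-Reymond lemma and regularity of weak solutions -/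

theorem exists_Icc_superset {K : Set ℝ} {a b : ℝ} (hab : a < b) (hK : IsCompact K)
    (hKab : K ⊆ Ioo a b) : ∃ c d, a < c ∧ d < b ∧ K ⊆ Icc c d := by
  rcases K.eq_empty_or_nonempty with rfl | hne
  · exact ⟨b, a, hab, hab, empty_subset _⟩
  · obtain ⟨c, hc⟩ := hK.exists_isLeast hne
    obtain ⟨d, hd⟩ := hK.exists_isGreatest hne
    exact ⟨c, d, (hKab hc.1).1, (hKab hd.1).2, fun x hx => ⟨hc.2 hx, hd.2 hx⟩⟩

/-- A test function with mean zero has a test function as primitive. -/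
theorem exists_testFunction_primitive {ℓ : ℝ} (hℓ : 0 < ℓ) {ζ : ℝ → ℝ} (hζ : ContDiff ℝ ∞ ζ)
    (hsupp : HasCompactSupport ζ) (hsub : tsupport ζ ⊆ Ioo 0 ℓ)
    (hmean : ∫ x in (0 : ℝ)..ℓ, ζ x = 0) :
    ∃ φ : ℝ → ℝ, ContDiff ℝ ∞ φ ∧ HasCompactSupport φ ∧ tsupport φ ⊆ Ioo 0 ℓ ∧ deriv φ = ζ := by
  obtain ⟨c, d, hc, hd, hcd⟩ := exists_Icc_superset hℓ hsupp hsub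
  have hζ0 : ∀ x, x ∉ Icc c d → ζ x = 0 := fun x hx =>
    image_eq_zero_of_notMem_tsupport fun h => hx (hcd h)
  have hder : ∀ x, HasDerivAt (fun x => ∫ s in (0 : ℝ)..x, ζ s) (ζ x) x := fun x =>
    (hζ.continuous.integral_hasStrictDerivAt 0 x).hasDerivAt
  have hd' : deriv (fun x => ∫ s in (0 : ℝ)..x, ζ s) = ζ := funext fun x => (hder x).deriv
  have hφ0 : ∀ x, x ∉ Icc c d → ∫ s in (0 : ℝ)..x, ζ s = 0 := by
    intro x hx
    by_cases hxc : x < c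
    · rw [intervalIntegral.integral_congr (g := fun _ => 0)]
      · simp
      · intro s hs
        refine hζ0 s fun hs' => ?_
        have : s ≤ max 0 x := hs.2
        have := max_lt hc hxc
        linarith [hs'.1]
    · have hxd : d < x := by
        by_contra! h
        exact hx ⟨not_lt.1 hxc, h⟩
      have h1 : ∫ s in x..ℓ, ζ s = 0 := by
        rw [intervalIntegral.integral_congr (g := fun _ => 0)]
        · simp
        · intro s hs
          refine hζ0 s fun hs' => ?_
          have : min x ℓ ≤ s := hs.1
          have := lt_min hxd hd
          linarith [hs'.2]
      rw [← intervalIntegral.integral_add_adjacent_intervals (b := x)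
        (hζ.continuous.intervalIntegrable _ _) (hζ.continuous.intervalIntegrable _ _), h1,
        add_zero] at hmean
      exact hmean
  have hts : tsupport (fun x => ∫ s in (0 : ℝ)..x, ζ s) ⊆ Icc c d :=
    closure_minimal (fun x hx => by_contra fun h => hx (hφ0 x h)) isClosed_Icc
  refine ⟨fun x => ∫ s in (0 : ℝ)..x, ζ s, ?_, ?_, hts.trans fun x hx =>
    ⟨hc.trans_le hx.1, hx.2.trans_lt hd⟩, hd'⟩
  · exact contDiff_infty_iff_deriv.2 ⟨fun x => (hder x).differentiableAt, by rwa [hd']⟩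
  · exact isCompact_Icc.of_isClosed_subset (isClosed_tsupport _) hts

/-- The du Bois-Reymond lemma, for a continuous function on a closed interval. -/
theorem exists_eqOn_const_of_hasWeakDeriv_zero {ℓ : ℝ} (hℓ : 0 < ℓ) {w : ℝ → ℝ}
    (hw : ContinuousOn w (Icc 0 ℓ)) (h : HasWeakDeriv ℓ w 0) :
    ∃ κ, ∀ x ∈ Icc 0 ℓ, w x = κ := by
  obtain ⟨η, hηs, hηc, hηd, hηr, hη1⟩ := exists_contDiff_tsupport_subset (n := ⊤)
    (Ioo_mem_nhds (show 0 < ℓ / 2 by linarith) (show ℓ / 2 < ℓ by linarith))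
  have hwu : ContinuousOn w (uIcc 0 ℓ) := by rwa [uIcc_of_le hℓ.le]
  have hI : 0 < ∫ x in (0 : ℝ)..ℓ, η x :=
    intervalIntegral.integral_pos hℓ hηd.continuous.continuousOn
      (fun x _ => (hηr (mem_range_self x)).1)
      ⟨ℓ / 2, ⟨by linarith, by linarith⟩, by rw [hη1]; exact one_pos⟩
  set κ := (∫ x in (0 : ℝ)..ℓ, w x * η x) / ∫ x in (0 : ℝ)..ℓ, η x with hκ
  have hint : ∀ ψ : ℝ → ℝ, Continuous ψ → IntervalIntegrable (fun x => w x * ψ x) volume 0 ℓ :=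
    fun ψ hψ => (hwu.mul hψ.continuousOn).intervalIntegrable
  have hae : ∀ᵐ x, x ∈ Ioo 0 ℓ → w x - κ = 0 := by
    refine isOpen_Ioo.ae_eq_zero_of_integral_contDiff_smul_eq_zero
      (((hw.mono Ioo_subset_Icc_self).sub continuousOn_const).locallyIntegrableOn
        measurableSet_Ioo) fun ψ hψd hψc hψs => ?_
    have h1 : ∫ x, ψ x • (w x - κ) = ∫ x in (0 : ℝ)..ℓ, ψ x * (w x - κ) := by
      rw [intervalIntegral.integral_of_le hℓ.le]
      refine (setIntegral_eq_integral_of_forall_compl_eq_zero fun x hx => ?_).symm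
      have : ψ x = 0 := image_eq_zero_of_notMem_tsupport fun hx' =>
        hx (Ioo_subset_Ioc_self (hψs hx'))
      simp [this]
    -- This `c` makes `ψ - c * η` of mean zero, hence the derivative of a test function, against
    -- which `w` integrates to zero.
    set c := (∫ x in (0 : ℝ)..ℓ, ψ x) / ∫ x in (0 : ℝ)..ℓ, η x with hc
    have hζsub : tsupport (fun x => ψ x - c * η x) ⊆ Ioo 0 ℓ := by
      refine (tsupport_sub ψ (fun x => c * η x)).trans (union_subset hψs ?_)
      exact (tsupport_mul_subset_right (f := fun _ => c) (g := η)).trans hηs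
    obtain ⟨φ, hφd, hφc, hφs, hφ⟩ := exists_testFunction_primitive hℓ
      (ζ := fun x => ψ x - c * η x) (hψd.sub (contDiff_const.mul hηd))
      (hψc.sub (hηc.mul_left (f := fun _ => c))) hζsub (by
        rw [intervalIntegral.integral_sub (hψd.continuous.intervalIntegrable _ _)
          ((hηd.continuous.const_mul c |>.intervalIntegrable _ _)),
          intervalIntegral.integral_const_mul, hc, div_mul_cancel₀ _ hI.ne', sub_self])
    have h2 := h φ hφd hφc hφs
    simp only [hφ, Pi.zero_apply, zero_mul, intervalIntegral.integral_zero, neg_zero] at h2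
    have h3 : ∀ x, w x * (ψ x - c * η x) = w x * ψ x - c * (w x * η x) := fun x => by ring
    simp_rw [h3] at h2
    rw [intervalIntegral.integral_sub (hint ψ hψd.continuous)
      ((hint η hηd.continuous).const_mul c), intervalIntegral.integral_const_mul] at h2
    have h4 : ∀ x, ψ x * (w x - κ) = w x * ψ x - κ * ψ x := fun x => by ring
    rw [h1]
    simp_rw [h4]
    rw [intervalIntegral.integral_sub (hint ψ hψd.continuous)
      ((hψd.continuous.const_mul κ).intervalIntegrable _ _), intervalIntegral.integral_const_mul,
      sub_eq_zero.1 h2, hκ, hc]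
    ring
  refine ⟨κ, fun x hx => ?_⟩
  refine Measure.eqOn_Icc_of_ae_eq volume hℓ.ne (g := fun _ => κ) ?_ hw continuousOn_const hx
  rw [← Measure.restrict_congr_set Ioo_ae_eq_Icc, EventuallyEq, ae_restrict_iff' measurableSet_Ioo]
  filter_upwards [hae] with y hy hy' using sub_eq_zero.1 (hy hy')

theorem intervalIntegrable_of_memLp_two {ℓ : ℝ} (hℓ : 0 ≤ ℓ) {g : ℝ → ℝ}
    (hg : MemLp g 2 (volume.restrict (Icc 0 ℓ))) : IntervalIntegrable g volume 0 ℓ := by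
  rw [intervalIntegrable_iff_integrableOn_Icc_of_le hℓ]
  exact hg.integrable one_le_two

theorem IsPrimitive.hasWeakDeriv {ℓ : ℝ} {u g : ℝ → ℝ} (hℓ : 0 ≤ ℓ) (hu : IsPrimitive ℓ u g) :
    HasWeakDeriv ℓ u g := by
  intro φ hφ _ hφs
  have h0 : ∀ x, x ∉ Ioo 0 ℓ → φ x = 0 := fun x hx =>
    image_eq_zero_of_notMem_tsupport fun h => hx (hφs h)
  rw [hu.integral_mul_add hℓ (IsPrimitive.of_contDiff (hφ.of_le (by exact_mod_cast le_top))),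
    h0 0 (by simp), h0 ℓ (by simp)]
  ring

/-- The difference between `u` and the primitive of `g` has zero weak derivative, so it is constant;
its value at `0` is `0`. -/
theorem IsH10.isPrimitive {ℓ : ℝ} {u g : ℝ → ℝ} (hℓ : 0 < ℓ) (hu : IsH10 ℓ u g) :
    IsPrimitive ℓ u g := by
  have hg := intervalIntegrable_of_memLp_two hℓ.le hu.memLp_deriv
  have hG : IsPrimitive ℓ (fun x => ∫ s in (0 : ℝ)..x, g s) g :=
    .of_integral hℓ.le hg 0 (by simp)
  have huu : ContinuousOn u (uIcc 0 ℓ) := by rw [uIcc_of_le hℓ.le]; exact hu.continuousOn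
  obtain ⟨κ, hκ⟩ := exists_eqOn_const_of_hasWeakDeriv_zero hℓ
    (w := fun x => u x - ∫ s in (0 : ℝ)..x, g s) (hu.continuousOn.sub (hG.continuousOn hℓ.le)) (by
      intro φ hφ hφc hφs
      have hφ' := hφ.continuous_deriv (by simp)
      simp only [sub_mul, Pi.zero_apply, zero_mul, intervalIntegral.integral_zero, neg_zero]
      have h1 : IntervalIntegrable (fun x => u x * deriv φ x) volume 0 ℓ :=
        (huu.mul hφ'.continuousOn).intervalIntegrable
      have h2 : IntervalIntegrable (fun x => (∫ s in (0 : ℝ)..x, g s) * deriv φ x) volume 0 ℓ :=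
        (hG.continuousOn_uIcc.mul hφ'.continuousOn).intervalIntegrable
      rw [intervalIntegral.integral_sub h1 h2, hu.hasWeakDeriv φ hφ hφc hφs,
        hG.hasWeakDeriv hℓ.le φ hφ hφc hφs, sub_self])
  have h0 := hκ 0 (left_mem_Icc.2 hℓ.le)
  simp only [hu.left_eq_zero, intervalIntegral.integral_same, sub_zero] at h0
  refine .of_integral hℓ.le hg 0 fun x hx => ?_
  rw [zero_add, ← sub_eq_zero, hκ x hx, h0]

theorem IsPrimitive.isH10 {ℓ : ℝ} {u g : ℝ → ℝ} (hℓ : 0 ≤ ℓ) (hu : IsPrimitive ℓ u g)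
    (h0 : u 0 = 0) (h1 : u ℓ = 0) (hg : MemLp g 2 (volume.restrict (Icc 0 ℓ))) : IsH10 ℓ u g :=
  ⟨hu.continuousOn hℓ, h0, h1, hg, hu.hasWeakDeriv hℓ⟩

theorem memLp_two_of_continuousOn {ℓ : ℝ} {F : ℝ → ℝ} (hF : ContinuousOn F (Icc 0 ℓ)) :
    MemLp F 2 (volume.restrict (Icc 0 ℓ)) := by
  obtain ⟨C, hC⟩ := isCompact_Icc.exists_bound_of_continuousOn hF
  exact MemLp.of_bound (hF.aestronglyMeasurable measurableSet_Icc) C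
    ((ae_restrict_iff' measurableSet_Icc).2 (ae_of_all _ hC))

/-- If `∫ g v' = ∫ f v` for all `v ∈ H¹₀(0, ℓ)`, then `g' = -f`. -/
theorem exists_ae_eq_sub_integral {ℓ : ℝ} {f g : ℝ → ℝ} (hℓ : 0 < ℓ)
    (hf : IntervalIntegrable f volume 0 ℓ) (hg : MemLp g 2 (volume.restrict (Icc 0 ℓ)))
    (hweak : ∀ v h, IsH10 ℓ v h → ∫ x in (0 : ℝ)..ℓ, g x * h x = ∫ x in (0 : ℝ)..ℓ, f x * v x) :
    ∃ c, ∀ᵐ x, x ∈ Ioo 0 ℓ → g x = c - ∫ s in (0 : ℝ)..x, f s := by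
  set F : ℝ → ℝ := fun x => ∫ s in (0 : ℝ)..x, f s with hFdef
  have hF : IsPrimitive ℓ F f := .of_integral hℓ.le hf 0 (by simp [hFdef])
  have hFL : MemLp F 2 (volume.restrict (Icc 0 ℓ)) :=
    memLp_two_of_continuousOn (hF.continuousOn hℓ.le)
  -- The mean of `g + F`. Subtracting it makes the primitive of `h` vanish at `ℓ`, so this primitive
  -- is an admissible test function.
  set κ := (∫ x in (0 : ℝ)..ℓ, (g x + F x)) / ℓ with hκ
  set h : ℝ → ℝ := fun x => g x + F x - κ
  have hgi := intervalIntegrable_of_memLp_two hℓ.le hg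
  have hFi := intervalIntegrable_of_memLp_two hℓ.le hFL
  have hhL : MemLp h 2 (volume.restrict (Icc 0 ℓ)) :=
    (hg.add hFL).sub (memLp_two_of_continuousOn continuousOn_const)
  have hhi := intervalIntegrable_of_memLp_two hℓ.le hhL
  have hmean : ∫ x in (0 : ℝ)..ℓ, h x = 0 := by
    simp only [h]
    rw [intervalIntegral.integral_sub (hgi.add hFi) intervalIntegrable_const,
      intervalIntegral.integral_const, hκ]
    simp only [sub_zero, smul_eq_mul]
    field_simp
    ring
  have hv : IsPrimitive ℓ (fun x => ∫ s in (0 : ℝ)..x, h s) h :=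
    .of_integral hℓ.le hhi 0 (by simp)
  have h1 := hweak _ h (hv.isH10 hℓ.le (by simp) hmean hhL)
  have h2 := hF.integral_mul_add hℓ.le hv
  rw [hmean, ← h1] at h2
  simp only [hFdef, intervalIntegral.integral_same, mul_zero, sub_zero, zero_sub] at h2
  have hprod : ∀ {a b : ℝ → ℝ}, MemLp a 2 (volume.restrict (Icc 0 ℓ)) →
      MemLp b 2 (volume.restrict (Icc 0 ℓ)) →
      IntervalIntegrable (fun x => a x * b x) volume 0 ℓ := fun ha hb => by
    rw [intervalIntegrable_iff_integrableOn_Icc_of_le hℓ.le]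
    exact ha.integrable_mul hb
  -- Testing with the primitive of `h` and integrating by parts gives `∫ g h = -∫ F h`, while `∫ κ h
  -- = 0`.
  have h3 : ∫ x in (0 : ℝ)..ℓ, h x * h x = 0 := by
    have h4 : ∀ x, h x * h x = g x * h x + F x * h x - κ * h x := fun x => by
      simp only [h]; ring
    simp_rw [h4]
    rw [intervalIntegral.integral_sub ((hprod hg hhL).add (hprod hFL hhL)) (hhi.const_mul κ),
      intervalIntegral.integral_add (hprod hg hhL) (hprod hFL hhL),
      intervalIntegral.integral_const_mul, hmean]
    linarith
  rw [intervalIntegral.integral_of_le hℓ.le, integral_eq_zero_iff_of_nonneg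
    (fun x => mul_self_nonneg _)
    ((intervalIntegrable_iff_integrableOn_Ioc_of_le hℓ.le).1 (hprod hhL hhL)),
    EventuallyEq, ae_restrict_iff' measurableSet_Ioc] at h3
  refine ⟨κ, ?_⟩
  filter_upwards [h3] with x hx hx'
  have h5 : h x = 0 := mul_self_eq_zero.1 (hx (Ioo_subset_Ioc_self hx'))
  simp only [h] at h5
  linarith

/-- Gives the slope at `0` its classical meaning: `G` extends continuously to the line, where the
fundamental theorem of calculus holds at every point. -/
theorem IsPrimitive.hasDerivWithinAt_zero {ℓ : ℝ} {u G : ℝ → ℝ} (hℓ : 0 < ℓ)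
    (hu : IsPrimitive ℓ u G) (hG : ContinuousOn G (Icc 0 ℓ)) :
    HasDerivWithinAt u (G 0) (Icc 0 ℓ) 0 := by
  have h0 : (0 : ℝ) ∈ Icc 0 ℓ := left_mem_Icc.2 hℓ.le
  have hc : Continuous (IccExtend hℓ.le ((Icc 0 ℓ).domRestrict G)) :=
    (continuousOn_iff_continuous_domRestrict.1 hG).Icc_extend'
  have h1 := ((hc.integral_hasStrictDerivAt 0 0).hasDerivAt.const_add (u 0)).hasDerivWithinAt
    (s := Icc 0 ℓ)
  rw [IccExtend_of_mem _ _ h0] at h1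
  have heq : ∀ x ∈ Icc 0 ℓ,
      u x = u 0 + ∫ s in (0 : ℝ)..x, IccExtend hℓ.le ((Icc 0 ℓ).domRestrict G) s := fun x hx => by
    rw [hu.eq_add_integral hx]
    congr 1
    refine intervalIntegral.integral_congr fun s hs => ?_
    rw [uIcc_of_le hx.1] at hs
    rw [IccExtend_of_mem _ _ ⟨hs.1, hs.2.trans hx.2⟩]
    rfl
  exact h1.congr heq (heq 0 h0)

/-! ### The first order system and the Prüfer transformation -/

/-- `(u, G)` solves the first order system `u' = G`, `G' = -lam (p u⁺ - q u⁻)` with initial value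
`(0, c)`. -/
structure IsFlow (ℓ lam : ℝ) (p q : ℝ → ℝ) (c : ℝ) (u G : ℝ → ℝ) : Prop where
  isPrimitive_fst : IsPrimitive ℓ u G
  isPrimitive_snd : IsPrimitive ℓ G (fun x => -(lam * (p x * (u x)⁺ - q x * (u x)⁻)))
  fst_zero : u 0 = 0
  snd_zero : G 0 = c

theorem mul_posPart_of_pos {r : ℝ} (hr : 0 < r) (x : ℝ) : (r * x)⁺ = r * x⁺ := by
  change max (r * x) 0 = r * max x 0
  rw [mul_max_of_nonneg _ _ hr.le, mul_zero]

theorem mul_negPart_of_pos {r : ℝ} (hr : 0 < r) (x : ℝ) : (r * x)⁻ = r * x⁻ := by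
  change max (-(r * x)) 0 = r * max (-x) 0
  rw [mul_max_of_nonneg _ _ hr.le, mul_zero, mul_neg]

theorem self_mul_posPart (x : ℝ) : x * x⁺ = x⁺ ^ 2 := by
  rcases le_total 0 x with h | h
  · rw [posPart_eq_self.2 h, sq]
  · rw [posPart_eq_zero.2 h]; ring

theorem self_mul_negPart (x : ℝ) : x * x⁻ = -x⁻ ^ 2 := by
  rcases le_total 0 x with h | h
  · rw [negPart_eq_zero.2 h]; ring
  · rw [negPart_eq_neg.2 h]; ring

section

variable {ℓ α β lam θ₀ c : ℝ} {p q θ u G : ℝ → ℝ}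

/-- The Prüfer transformation: a Prüfer angle comes from a solution of the first order system. -/
theorem IsAngle.exists_isFlow (hℓ : 0 ≤ ℓ) (hα : 0 ≤ α) (hp : IsWeight α β p)
    (hq : IsWeight α β q) (h0 : Real.sin θ₀ = 0) (hθ : IsAngle ℓ lam p q θ₀ θ) {r₀ : ℝ}
    (hr₀ : 0 < r₀) :
    ∃ r : ℝ → ℝ, (∀ x, 0 < r x) ∧ IsFlow ℓ lam p q (r₀ * Real.cos θ₀)
      (fun x => r x * Real.sin (θ x)) (fun x => r x * Real.cos (θ x)) := by
  set e : ℝ → ℝ := fun x => p x * (Real.sin (θ x))⁺ - q x * (Real.sin (θ x))⁻ with he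
  -- Differentiating `r² = u² + G²` along the system gives `r' = r * k`, so `r` is an exponential
  -- and stays positive.
  set k : ℝ → ℝ := fun x => Real.cos (θ x) * (Real.sin (θ x) - lam * e x) with hk
  have hc := hθ.continuous
  have hpi : IntervalIntegrable p volume 0 ℓ :=
    intervalIntegrable_of_abs_le hp.measurable (hp.abs_le hα) _ _
  have hqi : IntervalIntegrable q volume 0 ℓ :=
    intervalIntegrable_of_abs_le hq.measurable (hq.abs_le hα) _ _
  have hei : IntervalIntegrable e volume 0 ℓ :=
    (hpi.mul_continuousOn
      ((Real.continuous_sin.comp hc).sup continuous_const).continuousOn).sub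
    (hqi.mul_continuousOn
      ((Real.continuous_sin.comp hc).neg.sup continuous_const).continuousOn)
  have hki : IntervalIntegrable k volume 0 ℓ := by
    have h1 : IntervalIntegrable (fun x => Real.sin (θ x)) volume 0 ℓ :=
      (Real.continuous_sin.comp hc).intervalIntegrable _ _
    exact (h1.sub (hei.const_mul lam)).continuousOn_mul (Real.continuous_cos.comp hc).continuousOn
  have hfield : ∀ x, angleField lam p q x (θ x) =
      Real.cos (θ x) ^ 2 + lam * (Real.sin (θ x) * e x) := fun x => by
    have h1 := self_mul_posPart (Real.sin (θ x))
    have h2 := self_mul_negPart (Real.sin (θ x))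
    simp only [angleField, he]
    linear_combination (-lam * p x) * h1 + (lam * q x) * h2
  have hρ : IsPrimitive ℓ (fun x => Real.log r₀ + ∫ s in (0 : ℝ)..x, k s) k :=
    .of_integral hℓ hki (Real.log r₀) fun x _ => rfl
  have hr := hρ.comp (φ := Real.exp) Real.hasDerivAt_exp Real.continuous_exp
  set r : ℝ → ℝ := fun x => Real.exp (Real.log r₀ + ∫ s in (0 : ℝ)..x, k s) with hrdef
  have hrpos : ∀ x, 0 < r x := fun x => Real.exp_pos _
  have hr0 : r 0 = r₀ := by simp [hrdef, Real.exp_log hr₀]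
  have hθp := hθ.isPrimitive hℓ hα hp hq
  have hs := hθp.comp (φ := Real.sin) Real.hasDerivAt_sin Real.continuous_cos
  have hcs := hθp.comp (φ := Real.cos) Real.hasDerivAt_cos Real.continuous_sin.neg
  refine ⟨r, hrpos, ?_, ?_, ?_, ?_⟩
  · convert hr.mul hs using 2 with x
    rw [hfield]
    simp only [hk]
    change _ = r x * _ * _ + r x * _
    have h3 := Real.sin_sq_add_cos_sq (θ x)
    linear_combination (-r x * Real.cos (θ x)) * h3
  · convert hr.mul hcs using 2 with x
    rw [mul_posPart_of_pos (hrpos x), mul_negPart_of_pos (hrpos x), hfield]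
    simp only [hk]
    change _ = r x * _ * _ + r x * _
    have h3 := Real.sin_sq_add_cos_sq (θ x)
    have h4 : p x * (Real.sin (θ x))⁺ - q x * (Real.sin (θ x))⁻ = e x := rfl
    linear_combination (-lam * r x) * h4 + (lam * r x * e x) * h3
  · simp only [hθ.apply_zero hℓ, h0, mul_zero]
  · simp only [hθ.apply_zero hℓ, hr0]

/-- Positive and negative parts are 1-Lipschitz, so Grönwall with `r = 0` applies to `|u - u'| + |G
- G'|`. -/
theorem IsFlow.unique {u' G' : ℝ → ℝ} (hℓ : 0 ≤ ℓ) (hα : 0 ≤ α) (hp : IsWeight α β p)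
    (hq : IsWeight α β q) (h : IsFlow ℓ lam p q c u G) (h' : IsFlow ℓ lam p q c u' G') :
    u ℓ = u' ℓ := by
  have hβ : 0 ≤ β := hα.trans ((hp.lower 0).trans (hp.upper 0))
  set d : ℝ → ℝ := fun x => |u x - u' x| + |G x - G' x| with hd
  have hdu : ContinuousOn d (uIcc 0 ℓ) :=
    (h.isPrimitive_fst.continuousOn_uIcc.sub h'.isPrimitive_fst.continuousOn_uIcc).abs.add
      (h.isPrimitive_snd.continuousOn_uIcc.sub h'.isPrimitive_snd.continuousOn_uIcc).abs
  have hdi : IntervalIntegrable d volume 0 ℓ := hdu.intervalIntegrable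
  have hU := h.isPrimitive_fst.sub h'.isPrimitive_fst
  have hV := h.isPrimitive_snd.sub h'.isPrimitive_snd
  have key : ∀ x ∈ Icc 0 ℓ, d x ≤ (1 + 2 * (|lam| * β)) * ∫ s in (0 : ℝ)..x, d s := by
    intro x hx
    have hdx := intervalIntegrable_mono_Icc hdi hx
    have h1 : |u x - u' x| ≤ ∫ s in (0 : ℝ)..x, d s := by
      rw [hU.eq_add_integral hx, h.fst_zero, h'.fst_zero, sub_self, zero_add, ← Real.norm_eq_abs]
      refine intervalIntegral.norm_integral_le_of_norm_le hx.1 (ae_of_all _ fun s _ => ?_) hdx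
      simp only [hd, Real.norm_eq_abs]
      linarith [abs_nonneg (u s - u' s)]
    have h2 : |G x - G' x| ≤ ∫ s in (0 : ℝ)..x, 2 * (|lam| * β) * d s := by
      rw [hV.eq_add_integral hx, h.snd_zero, h'.snd_zero, sub_self, zero_add, ← Real.norm_eq_abs]
      refine intervalIntegral.norm_integral_le_of_norm_le hx.1 (ae_of_all _ fun s _ => ?_)
        (hdx.const_mul _)
      have h3 : |(u s)⁺ - (u' s)⁺| ≤ |u s - u' s| := abs_max_sub_max_le_abs _ _ 0
      have h4 : |(u s)⁻ - (u' s)⁻| ≤ |u s - u' s| := by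
        have : |(u s)⁻ - (u' s)⁻| ≤ |-u s - -u' s| := abs_max_sub_max_le_abs _ _ 0
        rwa [neg_sub_neg, abs_sub_comm (u' s)] at this
      have h5 : |p s * ((u s)⁺ - (u' s)⁺)| ≤ β * |u s - u' s| := by
        rw [abs_mul]
        exact mul_le_mul (hp.abs_le hα s) h3 (abs_nonneg _) hβ
      have h6 : |q s * ((u s)⁻ - (u' s)⁻)| ≤ β * |u s - u' s| := by
        rw [abs_mul]
        exact mul_le_mul (hq.abs_le hα s) h4 (abs_nonneg _) hβ
      have h7 : -(lam * (p s * (u s)⁺ - q s * (u s)⁻)) - -(lam * (p s * (u' s)⁺ - q s * (u' s)⁻)) =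
          -(lam * (p s * ((u s)⁺ - (u' s)⁺) - q s * ((u s)⁻ - (u' s)⁻))) := by ring
      rw [h7, Real.norm_eq_abs, abs_neg, abs_mul]
      calc |lam| * |p s * ((u s)⁺ - (u' s)⁺) - q s * ((u s)⁻ - (u' s)⁻)|
          ≤ |lam| * (β * |u s - u' s| + β * |u s - u' s|) := by
            gcongr
            exact (abs_sub _ _).trans (add_le_add h5 h6)
        _ = 2 * (|lam| * β) * |u s - u' s| := by ring
        _ ≤ 2 * (|lam| * β) * d s := by
            gcongr
            simp only [hd]
            linarith [abs_nonneg (G s - G' s)]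
    rw [intervalIntegral.integral_const_mul] at h2
    simp only [hd] at h1 h2 ⊢
    linarith
  have h8 := gronwall_integral (K := 1 + 2 * (|lam| * β)) (r := fun _ => 0) hℓ (by positivity) hdi
    intervalIntegrable_const (fun _ _ => le_rfl) (fun x hx => by rw [zero_add]; exact key x hx)
  simp only [intervalIntegral.integral_zero, mul_zero, add_zero, hd] at h8
  have h9 : |u ℓ - u' ℓ| ≤ 0 := by linarith [abs_nonneg (G ℓ - G' ℓ)]
  exact sub_eq_zero.1 (abs_nonpos_iff.1 h9)

theorem IsFlow.isHalfEigenfunction {t : ℝ} {m n : ℝ → ℝ} (hℓ : 0 < ℓ) (hc : c ≠ 0)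
    (h : IsFlow ℓ lam m (fun x => t * n x) c u G) (hend : u ℓ = 0) :
    IsHalfEigenfunction ℓ t m n lam u ∧ HasDerivWithinAt u c (Icc 0 ℓ) 0 := by
  have hG := h.isPrimitive_snd.continuousOn hℓ.le
  have hder := h.isPrimitive_fst.hasDerivWithinAt_zero hℓ hG
  rw [h.snd_zero] at hder
  refine ⟨⟨?_, G, h.isPrimitive_fst.isH10 hℓ.le h.fst_zero hend (memLp_two_of_continuousOn hG),
    fun v k hv => ?_⟩, hder⟩
  -- An identically zero `u` would have slope `0` at the left end point, against `c ≠ 0`.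
  · by_contra! hu
    refine hc ((uniqueDiffOn_Icc hℓ 0 (left_mem_Icc.2 hℓ.le)).eq_deriv _ hder ?_)
    exact (hasDerivWithinAt_const 0 (Icc 0 ℓ) (0 : ℝ)).congr hu h.fst_zero
  · rw [h.isPrimitive_snd.integral_mul_add hℓ.le (hv.isPrimitive hℓ), hv.left_eq_zero,
      hv.right_eq_zero, ← sub_eq_zero]
    simp only [neg_mul, intervalIntegral.integral_neg]
    ring

/-- The weak equation makes `g` agree almost everywhere with an absolutely continuous `G`. Then `u`
is differentiable at `0` with slope `G 0`, which must be `c`. -/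
theorem IsHalfEigenfunction.exists_isFlow {t : ℝ} {m n : ℝ → ℝ} (hℓ : 0 < ℓ) (hα : 0 ≤ α)
    (hm : IsWeight α β m) (hn : IsWeight α β fun x => t * n x)
    (h : IsHalfEigenfunction ℓ t m n lam u) (hder : HasDerivWithinAt u c (Icc 0 ℓ) 0) :
    u ℓ = 0 ∧ ∃ G, IsFlow ℓ lam m (fun x => t * n x) c u G := by
  obtain ⟨-, g, hu, hweak⟩ := h
  have huu : ContinuousOn u (uIcc 0 ℓ) := by rw [uIcc_of_le hℓ.le]; exact hu.continuousOn
  have hfi : IntervalIntegrable (fun x => lam * (m x * (u x)⁺ - t * n x * (u x)⁻)) volume 0 ℓ :=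
    (((intervalIntegrable_of_abs_le hm.measurable (hm.abs_le hα) _ _).mul_continuousOn
      (huu.sup continuousOn_const)).sub
      ((intervalIntegrable_of_abs_le hn.measurable (hn.abs_le hα) _ _).mul_continuousOn
      (huu.neg.sup continuousOn_const))).const_mul lam
  obtain ⟨κ, hκ⟩ := exists_ae_eq_sub_integral hℓ hfi hu.memLp_deriv hweak
  set f : ℝ → ℝ := fun x => lam * (m x * (u x)⁺ - t * n x * (u x)⁻)
  have hG : IsPrimitive ℓ (fun x => κ - ∫ s in (0 : ℝ)..x, f s) (fun x => -f x) := by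
    refine .of_integral hℓ.le hfi.neg κ fun x _ => ?_
    rw [intervalIntegral.integral_neg, sub_eq_add_neg]
  have hU := (hu.isPrimitive hℓ).congr_ae hG.continuousOn_uIcc.intervalIntegrable hκ
  have hder' := hU.hasDerivWithinAt_zero hℓ (hG.continuousOn hℓ.le)
  exact ⟨hu.right_eq_zero, _, hU, hG, hu.left_eq_zero,
    (uniqueDiffOn_Icc hℓ 0 (left_mem_Icc.2 hℓ.le)).eq_deriv _ hder' hder⟩

theorem halfSpectrum_eq {t σ : ℝ} {m n : ℝ → ℝ} (hℓ : 0 < ℓ) (hα : 0 ≤ α)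
    (hm : IsWeight α β m) (hn : IsWeight α β fun x => t * n x) (h0 : Real.sin θ₀ = 0)
    (hσ : Real.cos θ₀ = σ) :
    halfSpectrum ℓ t m n σ =
      {lam | Real.sin (endAngle ℓ lam m (fun x => t * n x) θ₀) = 0} := by
  have hσ2 : σ * σ = 1 := by
    have := Real.sin_sq_add_cos_sq θ₀
    rw [h0, hσ] at this
    linarith
  ext lam
  have hθ := isAngle_epsilon hℓ.le hα hm hn lam θ₀
  constructor
  · rintro ⟨u, c, hu, hder, hc⟩
    obtain ⟨hend, G, hflow⟩ := hu.exists_isFlow hℓ hα hm hn hder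
    -- Initial radius `σ * c > 0`: the polar solution has slope `σ * c * cos θ₀ = c` at `0`, so
    -- uniqueness identifies its end value with `u ℓ`.
    obtain ⟨r, hrpos, hr⟩ := hθ.exists_isFlow hℓ.le hα hm hn h0 hc
    rw [hσ, mul_right_comm, hσ2, one_mul] at hr
    have h1 := hflow.unique hℓ.le hα hm hn hr
    rw [hend] at h1
    exact (mul_eq_zero.1 h1.symm).resolve_left (hrpos ℓ).ne'
  · intro hlam
    obtain ⟨r, -, hr⟩ := hθ.exists_isFlow hℓ.le hα hm hn h0 one_pos
    rw [hσ, one_mul] at hr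
    have hσ0 : σ ≠ 0 := fun h => by simp [h] at hσ2
    have hend : r ℓ * Real.sin (endAngle ℓ lam m (fun x => t * n x) θ₀) = 0 := by
      rw [show Real.sin (endAngle ℓ lam m (fun x => t * n x) θ₀) = 0 from hlam, mul_zero]
    obtain ⟨h1, h2⟩ := hr.isHalfEigenfunction hℓ hσ0 hend
    exact ⟨_, σ, h1, h2, by rw [hσ2]; exact one_pos⟩

end

/-! ### Enumeration, representatives of the weights, and weak* limits -/

theorem nthSmallest_range {s : ℕ → ℝ} (hs : StrictMono s) (k : ℕ) :
    nthSmallest (range s) k = s k := by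
  induction k with
  | zero =>
    refine IsLeast.csInf_eq ⟨mem_range_self 0, ?_⟩
    rintro _ ⟨j, rfl⟩
    exact hs.monotone j.zero_le
  | succ k ih =>
    rw [nthSmallest, ih]
    refine IsLeast.csInf_eq ⟨⟨mem_range_self _, hs k.lt_succ_self⟩, ?_⟩
    rintro _ ⟨⟨j, rfl⟩, hj⟩
    exact hs.monotone (Nat.succ_le_of_lt (hs.lt_iff_lt.1 hj))

theorem isIncreasingEnumeration_nthSmallest {S : Set ℝ} {s : ℕ → ℝ} (hs : StrictMono s)
    (hS : range s = S) (hlim : Tendsto s atTop atTop) :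
    IsIncreasingEnumeration S (nthSmallest S) := by
  have h : nthSmallest S = s := funext fun k => hS ▸ nthSmallest_range hs k
  rw [h]
  exact ⟨hs, hS, hlim⟩

/-- A measurable representative of `m`, truncated to values in `[a, b]`. -/
noncomputable def truncWeight (ℓ a b : ℝ) (m : ℝ → ℝ) : ℝ → ℝ :=
  open scoped Classical in
  if h : AEStronglyMeasurable m (volume.restrict (Icc 0 ℓ)) then
    fun x => max a (min b (h.mk m x)) else fun _ => a

section

variable {ℓ a b : ℝ} {m n : ℝ → ℝ}

theorem isWeight_truncWeight (hab : a ≤ b) (m : ℝ → ℝ) : IsWeight a b (truncWeight ℓ a b m) := by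
  unfold truncWeight
  split_ifs with h
  · exact ⟨measurable_const.max (measurable_const.min h.stronglyMeasurable_mk.measurable),
      fun x => le_max_left _ _, fun x => max_le hab (min_le_left _ _)⟩
  · exact ⟨measurable_const, fun _ => le_rfl, fun _ => hab⟩

theorem truncWeight_ae_eq (hm : IsBoundedWeight ℓ m) (hb : BetweenBounds ℓ a b m) :
    m =ᵐ[volume.restrict (Icc 0 ℓ)] truncWeight ℓ a b m := by
  have h : AEStronglyMeasurable m (volume.restrict (Icc 0 ℓ)) := hm.1
  rw [truncWeight, dif_pos h]
  filter_upwards [hb, h.ae_eq_mk] with x hx hx'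
  rw [← hx', min_eq_right hx.2, max_eq_right hx.1]

theorem IsWeight.mono {a' b' : ℝ} (hm : IsWeight a b m) (ha : a' ≤ a) (hb : b ≤ b') :
    IsWeight a' b' m :=
  ⟨hm.measurable, fun x => ha.trans (hm.lower x), fun x => (hm.upper x).trans hb⟩

theorem IsWeight.const_mul (hm : IsWeight a b m) {t : ℝ} (ht : 0 ≤ t) :
    IsWeight (t * a) (t * b) fun x => t * m x :=
  ⟨hm.measurable.const_mul t, fun x => mul_le_mul_of_nonneg_left (hm.lower x) ht,
    fun x => mul_le_mul_of_nonneg_left (hm.upper x) ht⟩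

theorem halfSpectrum_congr {t σ : ℝ} {m' n' : ℝ → ℝ} (hℓ : 0 ≤ ℓ)
    (hm : m =ᵐ[volume.restrict (Icc 0 ℓ)] m') (hn : n =ᵐ[volume.restrict (Icc 0 ℓ)] n') :
    halfSpectrum ℓ t m n σ = halfSpectrum ℓ t m' n' σ := by
  have key : ∀ (lam : ℝ) (u v : ℝ → ℝ),
      ∫ x in (0 : ℝ)..ℓ, lam * (m x * (u x)⁺ - t * n x * (u x)⁻) * v x =
        ∫ x in (0 : ℝ)..ℓ, lam * (m' x * (u x)⁺ - t * n' x * (u x)⁻) * v x := by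
    intro lam u v
    rw [intervalIntegral.integral_of_le hℓ, intervalIntegral.integral_of_le hℓ,
      ← integral_Icc_eq_integral_Ioc, ← integral_Icc_eq_integral_Ioc]
    refine integral_congr_ae ?_
    filter_upwards [hm, hn] with x hx hx'
    rw [hx, hx']
  simp only [halfSpectrum, IsHalfEigenfunction, key]

theorem integral_mul_congr {x : ℝ} {f : ℝ → ℝ} (hx : x ∈ Icc 0 ℓ)
    (hm : m =ᵐ[volume.restrict (Icc 0 ℓ)] n) :
    ∫ s in (0 : ℝ)..x, m s * f s = ∫ s in (0 : ℝ)..x, n s * f s := by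
  rw [intervalIntegral.integral_of_le hx.1, intervalIntegral.integral_of_le hx.1]
  refine integral_congr_ae ?_
  have := ae_mono (Measure.restrict_mono
    (Ioc_subset_Icc_self.trans (Icc_subset_Icc_right hx.2)) le_rfl) hm
  filter_upwards [this] with s hs
  rw [hs]

/-- The indicator of `(0, x]` times `f` is itself an integrable test function. -/
theorem WeakStarTendsto.tendsto_integral {m : ℝ → ℝ → ℝ} {m₀ : ℝ → ℝ}
    (h : WeakStarTendsto ℓ m m₀) {f : ℝ → ℝ} (hf : Continuous f) {x : ℝ} (hx : x ∈ Icc 0 ℓ) :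
    Tendsto (fun ε => ∫ s in (0 : ℝ)..x, m ε s * f s) (𝓝[>] 0)
      (𝓝 (∫ s in (0 : ℝ)..x, m₀ s * f s)) := by
  have key : ∀ w : ℝ → ℝ, ∫ s in (0 : ℝ)..ℓ, w s * (Ioc 0 x).indicator f s =
      ∫ s in (0 : ℝ)..x, w s * f s := fun w => by
    rw [intervalIntegral.integral_of_le (hx.1.trans hx.2), intervalIntegral.integral_of_le hx.1]
    have : ∀ s, w s * (Ioc 0 x).indicator f s = (Ioc 0 x).indicator (fun s => w s * f s) s :=
      fun s => (indicator_mul_right (Ioc 0 x) w f).symm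
    simp_rw [this]
    rw [integral_indicator measurableSet_Ioc, Measure.restrict_restrict measurableSet_Ioc,
      inter_eq_left.2 (Ioc_subset_Ioc_right hx.2)]
  have h1 := h ((Ioc 0 x).indicator f)
    ((hf.integrableOn_Icc (a := 0) (b := ℓ)).indicator measurableSet_Ioc)
  simpa only [key] using h1

/-- Testing with indicators passes the inequalities between set integrals to the limit, and these
determine the bounds almost everywhere. -/
theorem WeakStarTendsto.betweenBounds {m : ℝ → ℝ → ℝ} {m₀ : ℝ → ℝ} (hℓ : 0 ≤ ℓ)
    (hm : ∀ ε, 0 < ε → IsBoundedWeight ℓ (m ε)) (hb : ∀ ε, 0 < ε → BetweenBounds ℓ a b (m ε))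
    (hm₀ : IsBoundedWeight ℓ m₀) (h : WeakStarTendsto ℓ m m₀) : BetweenBounds ℓ a b m₀ := by
  set μ := volume.restrict (Icc (0 : ℝ) ℓ) with hμ
  have hint : ∀ w, IsBoundedWeight ℓ w → Integrable w μ := fun w hw => hw.integrable le_top
  have key : ∀ (w : ℝ → ℝ) (s : Set ℝ), MeasurableSet s →
      ∫ x in (0 : ℝ)..ℓ, w x * s.indicator (fun _ => (1 : ℝ)) x = ∫ x in s, w x ∂μ := by
    intro w s hs
    rw [intervalIntegral.integral_of_le hℓ, ← integral_Icc_eq_integral_Ioc, ← integral_indicator hs]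
    congr 1
    ext x
    by_cases hx : x ∈ s <;> simp [hx]
  have hlim : ∀ s, MeasurableSet s →
      Tendsto (fun ε => ∫ x in s, m ε x ∂μ) (𝓝[>] 0) (𝓝 (∫ x in s, m₀ x ∂μ)) := fun s hs => by
    have h1 := h (s.indicator fun _ => (1 : ℝ)) ((integrable_const (1 : ℝ)).indicator hs)
    simpa only [key _ s hs] using h1
  have hpos : ∀ᶠ ε : ℝ in 𝓝[>] 0, 0 < ε := self_mem_nhdsWithin
  have hlow : (fun _ => a) ≤ᵐ[μ] m₀ := by
    refine ae_le_of_forall_setIntegral_le (integrable_const a) (hint _ hm₀) fun s hs _ => ?_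
    refine ge_of_tendsto (hlim s hs) (hpos.mono fun ε hε => ?_)
    exact setIntegral_mono_ae (integrable_const a).integrableOn (hint _ (hm ε hε)).integrableOn
      ((hb ε hε).mono fun x hx => hx.1)
  have hup : m₀ ≤ᵐ[μ] fun _ => b := by
    refine ae_le_of_forall_setIntegral_le (hint _ hm₀) (integrable_const b) fun s hs _ => ?_
    refine le_of_tendsto (hlim s hs) (hpos.mono fun ε hε => ?_)
    exact setIntegral_mono_ae (hint _ (hm ε hε)).integrableOn (integrable_const b).integrableOn
      ((hb ε hε).mono fun x hx => hx.2)
  filter_upwards [hlow, hup] with x h1 h2 using ⟨h1, h2⟩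

theorem BetweenBounds.le (hℓ : 0 < ℓ) (h : BetweenBounds ℓ a b m) : a ≤ b := by
  have : NeBot (ae (volume.restrict (Icc 0 ℓ))) := by
    rw [ae_restrict_neBot, Real.volume_Icc]
    simpa using hℓ
  obtain ⟨x, hx⟩ := h.exists
  exact hx.1.trans hx.2

end

end HalfEigen

/-! ### The main theorem -/

theorem theorem3p1 (ℓ a b t : ℝ) (hℓ : 0 < ℓ) (ha : 0 < a) (ht : 0 < t)
    (m n : ℝ → ℝ → ℝ) (m₀ n₀ : ℝ → ℝ)
    (hm : ∀ ε, 0 < ε → HalfEigen.IsBoundedWeight ℓ (m ε))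
    (hn : ∀ ε, 0 < ε → HalfEigen.IsBoundedWeight ℓ (n ε))
    (hm_bounds : ∀ ε, 0 < ε → HalfEigen.BetweenBounds ℓ a b (m ε))
    (hn_bounds : ∀ ε, 0 < ε → HalfEigen.BetweenBounds ℓ a b (n ε))
    (hm₀ : HalfEigen.IsBoundedWeight ℓ m₀)
    (hn₀ : HalfEigen.IsBoundedWeight ℓ n₀)
    (hm_lim : HalfEigen.WeakStarTendsto ℓ m m₀)
    (hn_lim : HalfEigen.WeakStarTendsto ℓ n n₀)
    (σ : ℝ) (hσ : σ = 1 ∨ σ = -1) :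
    (∀ ε, 0 < ε → HalfEigen.IsIncreasingEnumeration
        (HalfEigen.halfSpectrum ℓ t (m ε) (n ε) σ)
        (HalfEigen.halfEigenvalue ℓ t (m ε) (n ε) σ)) ∧
    HalfEigen.IsIncreasingEnumeration
        (HalfEigen.halfSpectrum ℓ t m₀ n₀ σ)
        (HalfEigen.halfEigenvalue ℓ t m₀ n₀ σ) ∧
    ∀ k : ℕ, Tendsto (fun ε : ℝ => HalfEigen.halfEigenvalue ℓ t (m ε) (n ε) σ k) (𝓝[>] 0)
      (𝓝 (HalfEigen.halfEigenvalue ℓ t m₀ n₀ σ k)) := by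
  open HalfEigen in
  have hm₀_bounds := hm_lim.betweenBounds hℓ.le hm hm_bounds hm₀
  have hn₀_bounds := hn_lim.betweenBounds hℓ.le hn hn_bounds hn₀
  have hab : a ≤ b := hm₀_bounds.le hℓ
  obtain ⟨θ₀, h0, hθσ⟩ : ∃ θ₀ : ℝ, Real.sin θ₀ = 0 ∧ Real.cos θ₀ = σ := by
    rcases hσ with rfl | rfl
    · exact ⟨0, by simp⟩
    · exact ⟨Real.pi, by simp⟩
  -- The angle lemmas ask for one pair of bounds shared by `m` and `t * n`.
  have hα : 0 < min a (t * a) := by positivity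
  have hp : ∀ w, IsWeight (min a (t * a)) (max b (t * b)) (truncWeight ℓ a b w) := fun w =>
    (isWeight_truncWeight hab w).mono (min_le_left _ _) (le_max_left _ _)
  have hq : ∀ w, IsWeight (min a (t * a)) (max b (t * b)) (fun x => t * truncWeight ℓ a b w x) :=
    fun w => ((isWeight_truncWeight hab w).const_mul ht.le).mono (min_le_right _ _)
      (le_max_right _ _)
  -- Truncation makes any functions admissible weights, so the roots exist for all `v`, `w`. This
  -- matters for `ε ≤ 0`, where nothing is assumed on `m ε` and `n ε` although
  -- `tendsto_of_endAngle_eq` quantifies over every index.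
  choose s hs hsmono hslim hsrange using fun v w : ℝ → ℝ =>
    exists_endAngle_eq (θ₀ := θ₀) hℓ hα (hp v) (hq w) h0
  have hspec : ∀ {v w : ℝ → ℝ}, IsBoundedWeight ℓ v → IsBoundedWeight ℓ w →
      BetweenBounds ℓ a b v → BetweenBounds ℓ a b w →
      range (s v w) = halfSpectrum ℓ t v w σ := fun {v w} hv hw hvb hwb => by
    rw [halfSpectrum_congr hℓ.le (truncWeight_ae_eq hv hvb) (truncWeight_ae_eq hw hwb),
      halfSpectrum_eq hℓ hα.le (hp v) (hq w) h0 hθσ, hsrange]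
  have heig : ∀ {v w : ℝ → ℝ}, IsBoundedWeight ℓ v → IsBoundedWeight ℓ w →
      BetweenBounds ℓ a b v → BetweenBounds ℓ a b w → ∀ k,
      halfEigenvalue ℓ t v w σ k = s v w k := fun {v w} hv hw hvb hwb k => by
    rw [halfEigenvalue, ← hspec hv hw hvb hwb, nthSmallest_range (hsmono v w)]
  refine ⟨fun ε hε => isIncreasingEnumeration_nthSmallest (hsmono (m ε) (n ε))
      (hspec (hm ε hε) (hn ε hε) (hm_bounds ε hε) (hn_bounds ε hε)) (hslim _ _),
    isIncreasingEnumeration_nthSmallest (hsmono m₀ n₀) (hspec hm₀ hn₀ hm₀_bounds hn₀_bounds)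
      (hslim _ _), fun k => ?_⟩
  rw [heig hm₀ hn₀ hm₀_bounds hn₀_bounds]
  have hpos : ∀ᶠ ε : ℝ in 𝓝[>] 0, 0 < ε := self_mem_nhdsWithin
  have htrunc : ∀ {w : ℝ → ℝ → ℝ} {w₀ : ℝ → ℝ}, (∀ ε, 0 < ε → IsBoundedWeight ℓ (w ε)) →
      (∀ ε, 0 < ε → BetweenBounds ℓ a b (w ε)) → IsBoundedWeight ℓ w₀ →
      BetweenBounds ℓ a b w₀ → WeakStarTendsto ℓ w w₀ →
      ∀ f : ℝ → ℝ, Continuous f → ∀ x ∈ Icc 0 ℓ,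
      Tendsto (fun ε => ∫ y in (0 : ℝ)..x, truncWeight ℓ a b (w ε) y * f y) (𝓝[>] 0)
        (𝓝 (∫ y in (0 : ℝ)..x, truncWeight ℓ a b w₀ y * f y)) := by
    intro w w₀ hw hwb hw₀ hwb₀ hlim f hf x hx
    rw [← integral_mul_congr hx (truncWeight_ae_eq hw₀ hwb₀)]
    refine (hlim.tendsto_integral hf hx).congr' (hpos.mono fun ε hε => ?_)
    exact integral_mul_congr hx (truncWeight_ae_eq (hw ε hε) (hwb ε hε))
  have hlim : Tendsto (fun ε => s (m ε) (n ε) k) (𝓝[>] 0) (𝓝 (s m₀ n₀ k)) := by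
    refine tendsto_of_endAngle_eq hℓ hα (hp m₀) (hq n₀) (fun ε => hp (m ε)) (fun ε => hq (n ε))
      (htrunc hm hm_bounds hm₀ hm₀_bounds hm_lim) (fun f hf x hx => ?_) h0 (hs m₀ n₀ k)
      fun ε => hs (m ε) (n ε) k
    simp only [mul_assoc, intervalIntegral.integral_const_mul]
    exact (htrunc hn hn_bounds hn₀ hn₀_bounds hn_lim f hf x hx).const_mul t
  refine hlim.congr' (hpos.mono fun ε hε => ?_)
  exact (heig (hm ε hε) (hn ε hε) (hm_bounds ε hε) (hn_bounds ε hε) k).symm
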